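/- **Setting.** Let $\mathcal X\subset\mathbb R^n$ be non-empty, convex and compact, let $f_1,\dots,f_N$ be (possibly non-smooth) convex functions on $\mathcal X$, put $f(x)=\frac1N\sum_{j=1}^N f_j(x)$, and let $x^*$ be a minimizer of $f$ over $\mathcal X$. Norms are Euclidean, and $\partial f_i(a)=\{g:\ f_i(b)\ge f_i(a)+\langle g,b-a\rangle\ \text{for all } b\in\mathcal X\}$. *Network.* For every $t\ge 0$ let $P(t)\in\mathbb R^{N\times N}$ be doubly stochastic, with a directed edge from $j$ to $i$ at time $t$ if and only if $[P(t)]_{ij}\neq0$. There are an integer $B_0\ge1$ and $\theta\in(0,1)$ such that for each $c\ge0$ the union of the graphs at times $cB_0+1,\dots,(c+1)B_0$ is strongly connected, $[P(t)]_{ij}\ge\theta$ on every edge, and $[P(t)]_{jj}\ge\theta$ for all $j$ and $t$. *Distance function.* Let $\phi:\mathbb R^n\to\mathbb R$ be continuously differentiable and, for some $\sigma_\phi>0$, $\sigma_\phi$-strongly convex, i.e. $\phi(b)\ge\phi(a)+\langle\nabla\phi(a),b-a\rangle+\frac{\sigma_\phi}2\|b-a\|^2$, with $\|\nabla\phi(a)-\nabla\phi(b)\|\le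 L_\phi\|a-b\|$ for all $a,b\in\mathbb R^n$. Let $V_\phi(a,b)=\phi(a)-\phi(b)-\langle\nabla\phi(b),a-b\rangle$ be its Bregman divergence, and assume $V_\phi(a,\sum_{j=1}^N w_jb_j)\le\sum_{j=1}^N w_jV_\phi(a,b_j)$ for all $a,b_1,\dots,b_N\in\mathbb R^n$ and all $w_j\ge0$ with $\sum_j w_j=1$, and $V_\phi(a,b)\le D_\phi$ for all $a,b\in\mathcal X$. *Quantizer.* For an integer $K\ge1$ let $Q(z,d,x)=z-d$ if $x-z<-d$, $Q(z,d,x)=z+d$ if $x-z\ge d$, and $Q(z,d,x)=z+\frac{(2j-K)d}{K}$ if $\frac{2jd}{K}\le x-z+d<\frac{2(j+1)d}{K}$ with $j\in\{0,\dots,K-1\}$. Let $\widehat Q$ act coordinatewise on $\mathbb R^n$. *Algorithm with delay $\tau\in\{0,1,2,\dots\}$.* Let $(\alpha(t))_{t\ge 0}$ and $(\beta(t))_{t\ge 0}$ be non-increasing sequences in $(0,1)$. Start from $x_i(0)\in\mathcal X$, $z_i(0)=x_i(0)$ and $\tilde y_i(-\tau),\dots,\tilde y_i(-1)\in\mathcal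 X$. For $t=0,1,2,\dots$ and $i=1,\dots,N$ set $d(t)=\frac{G\alpha(t)\beta(t)}{\sigma_\phi}\mathbf 1$, $y_i(t)=\sum_{j=1}^N[P(t)]_{ij}\widehat Q(z_j(t),d(t),x_j(t))$, let $\tilde y_i(t)$ be the Euclidean projection of $y_i(t)$ onto $\mathcal X$, choose $g_i(t-\tau)\in\partial f_i(\tilde y_i(t-\tau))$, and put $$z_i(t+1)=\arg\min_{x\in\mathcal X}\Big\{\langle g_i(t-\tau),x\rangle+\tfrac{V_\phi(x,\tilde y_i(t))}{\alpha(t+1)(1-\beta(t+1))}\Big\},\qquad x_i(t+1)=\arg\min_{x\in\mathcal X}\Big\{\langle g_i(t-\tau),x\rangle+\tfrac{V_\phi(x,\tilde y_i(t))}{\alpha(t+1)}\Big\}.$$ Assume that the subgradients are bounded by $G$: at every point of $\mathcal X$ each $f_i$ has a subgradient of norm at most $G$, and the subgradients used by the algorithm have norm at most $G$. **Theorem.** Put $\hat x_l(T)=\frac1T\sum_{t=1}^Tx_l(t)$, $E(t)=\frac{Gn}{\sigma_\phi}\alpha(t)\beta(t)$, $\omega=(1-\frac{\theta}{4N^2})^{-2}$,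 $\gamma=(1-\frac{\theta}{4N^2})^{1/B_0}$, $A=\sum_{j=1}^N\|x_j(0)\|$ and $B=2N+\frac{N^2\omega}{1-\gamma}$. Then for every agent $l$ and every $T\ge1$, $$\begin{aligned}f(\hat x_l(T))-f(x^*)\le{}&\Big\{\tfrac{(2B+1)G^2\tau}{\sigma_\phi}+\tfrac{G^2}{2\sigma_\phi}+\tfrac{2BG^2}{N\sigma_\phi}\Big\}\frac1T\sum_{t=0}^{T+\tau}\alpha(t)+\big\{(6B+3)NG\tau+6BG+3NG\big\}\frac1T\sum_{t=0}^{T+\tau}E(t)\\&+\Big\{\tfrac{2NAG\tau\omega}{1-\gamma}+\tfrac{2AG\omega}{1-\gamma}\Big\}\frac1T+\frac{L_\phi(8N^2+2)}T\sum_{t=0}^{T+\tau}\frac{E(t)^2}{\alpha(t)}\\&+\frac{(2N+1)L_\phi}T\sqrt{\frac{2D_\phi}{\sigma_\phi}}\sum_{t=0}^{T+\tau}\frac{E(t)}{\alpha(t)}+\frac{D_\phi}{T\alpha(T+\tau)}.\end{aligned}$$ -/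

import Mathlib

noncomputable section

/-- The scalar uniform quantizer with mid-value `z`, interval size `d` and levels
`z - d, z - d + 2 d / K, ..., z + d`.  Inside the quantization interval the level index is the
integer `j` with `2 j d / K ≤ x - z + d < 2 (j + 1) d / K`. -/
def quantize (K : ℕ) (z d x : ℝ) : ℝ :=
  if x - z < -d then z - d
  else if d ≤ x - z then z + d
  else z + (2 * (⌊(x - z + d) * K / (2 * d)⌋ : ℝ) - K) * d / K

/-- The quantizer on `ℝⁿ`, acting coordinate by coordinate. -/
def quantizeVec {n : ℕ} (K : ℕ) (z d x : EuclideanSpace ℝ (Fin n)) : EuclideanSpace ℝ (Fin n) :=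
  WithLp.toLp 2 (fun k => quantize K (z k) (d k) (x k))

/-- The Bregman divergence `V_φ(a, b) = φ(a) - φ(b) - ⟨∇φ(b), a - b⟩`. -/
def bregman {n : ℕ} (φ : EuclideanSpace ℝ (Fin n) → ℝ) (a b : EuclideanSpace ℝ (Fin n)) : ℝ :=
  φ a - φ b - inner ℝ (gradient φ b) (a - b)

/-- The subdifferential at `a` of a function that is considered on the set `X` only. -/
def subdifferentialOn {n : ℕ} (X : Set (EuclideanSpace ℝ (Fin n)))
    (h : EuclideanSpace ℝ (Fin n) → ℝ) (a : EuclideanSpace ℝ (Fin n)) :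
    Set (EuclideanSpace ℝ (Fin n)) :=
  {g | ∀ b ∈ X, h a + inner ℝ g (b - a) ≤ h b}

/-- The point `u` is a minimizer of `h` over `X`. -/
def IsArgminOn {n : ℕ} (X : Set (EuclideanSpace ℝ (Fin n)))
    (h : EuclideanSpace ℝ (Fin n) → ℝ) (u : EuclideanSpace ℝ (Fin n)) : Prop :=
  u ∈ X ∧ IsMinOn h X u

/-- The global objective, the average of the local functions. -/
def objective {n N : ℕ} (f : Fin N → EuclideanSpace ℝ (Fin n) → ℝ)
    (u : EuclideanSpace ℝ (Fin n)) : ℝ :=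
  (1 / (N : ℝ)) * ∑ j, f j u

/-- `B₀`-connectivity of the time-varying digraph with an edge `j → i` at time `t` if and only if
`[P(t)]_{ij} ≠ 0`: the union of the graphs over every block `c B₀ + 1, ..., (c + 1) B₀` is strongly
connected, and the weights on edges and on the diagonal are at least `θ`. -/
structure IsBConnected {N : ℕ} (P : ℕ → Matrix (Fin N) (Fin N) ℝ) (B₀ : ℕ) (θ : ℝ) : Prop where
  block_pos : 1 ≤ B₀
  theta_pos : 0 < θ
  theta_lt_one : θ < 1
  edge_weight : ∀ t i j, P t i j ≠ 0 → θ ≤ P t i j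
  diag_weight : ∀ t j, θ ≤ P t j j
  strongly_connected : ∀ (c : ℕ) (u v : Fin N),
    Relation.ReflTransGen
      (fun j i => ∃ t, c * B₀ + 1 ≤ t ∧ t ≤ (c + 1) * B₀ ∧ P t i j ≠ 0) u v

/-- The common quantization interval size vector `d(t) = (G α(t) β(t) / σ) 𝟏`. -/
def intervalSize (n : ℕ) (G σ : ℝ) (α β : ℕ → ℝ) (t : ℕ) : EuclideanSpace ℝ (Fin n) :=
  WithLp.toLp 2 (fun _ => G * α t * β t / σ)

/-- The sequences `x_i(t)`, `z_i(t)`, `y_i(t)` (`t ≥ 0`), `ỹ_i(s)`, `g_i(s)` (`s ≥ -τ`) are generated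
by the mirror descent algorithm with subgradient delay `τ` under adaptive quantization. -/
structure IsAlgorithmRun {n N : ℕ} (X : Set (EuclideanSpace ℝ (Fin n)))
    (f : Fin N → EuclideanSpace ℝ (Fin n) → ℝ) (φ : EuclideanSpace ℝ (Fin n) → ℝ)
    (P : ℕ → Matrix (Fin N) (Fin N) ℝ) (α β : ℕ → ℝ) (G σ : ℝ) (τ K : ℕ)
    (x z y : Fin N → ℕ → EuclideanSpace ℝ (Fin n))
    (yt g : Fin N → ℤ → EuclideanSpace ℝ (Fin n)) : Prop where
  x_zero : ∀ i, x i 0 ∈ X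
  z_zero : ∀ i, z i 0 = x i 0
  yt_init : ∀ i, ∀ s : ℤ, -(τ : ℤ) ≤ s → s < 0 → yt i s ∈ X
  y_eq : ∀ i t, y i t = ∑ j, P t i j • quantizeVec K (z j t) (intervalSize n G σ α β t) (x j t)
  yt_proj : ∀ i, ∀ t : ℕ, IsArgminOn X (fun u => ‖u - y i t‖) (yt i t)
  g_mem : ∀ i, ∀ t : ℕ, g i ((t : ℤ) - τ) ∈ subdifferentialOn X (f i) (yt i ((t : ℤ) - τ))
  z_succ : ∀ i, ∀ t : ℕ, IsArgminOn X
    (fun u => inner ℝ (g i ((t : ℤ) - τ)) u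
      + bregman φ u (yt i t) / (α (t + 1) * (1 - β (t + 1)))) (z i (t + 1))
  x_succ : ∀ i, ∀ t : ℕ, IsArgminOn X
    (fun u => inner ℝ (g i ((t : ℤ) - τ)) u + bregman φ u (yt i t) / α (t + 1)) (x i (t + 1))

/-- The running average `(1/T) ∑_{t=1}^T x(t)` of one agent's states. -/
def runningAverage {n : ℕ} (x : ℕ → EuclideanSpace ℝ (Fin n)) (T : ℕ) :
    EuclideanSpace ℝ (Fin n) :=
  (1 / (T : ℝ)) • ∑ t ∈ Finset.Icc 1 T, x t

/-- `E(t) = (G n / σ) α(t) β(t)`. -/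
def quantErr (n : ℕ) (G σ : ℝ) (α β : ℕ → ℝ) (t : ℕ) : ℝ := G * n / σ * α t * β t

/-- `ω = (1 - θ / (4 N²))⁻²`. -/
def omegaConst (N : ℕ) (θ : ℝ) : ℝ := ((1 - θ / (4 * (N : ℝ) ^ 2)) ^ 2)⁻¹

/-- `γ = (1 - θ / (4 N²))^{1 / B₀}`. -/
def gammaConst (N B₀ : ℕ) (θ : ℝ) : ℝ := (1 - θ / (4 * (N : ℝ) ^ 2)) ^ (1 / (B₀ : ℝ))

end

/-!
The subgradients enter delayed by `τ`, the states are quantized before they are averaged, and the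
averages are projected. The proof compares the states `x_i(t)` with a perturbed linear averaging
iteration and the points `ỹ_i(t)` with an exact mirror descent.

*Consensus.* One averaging step with a doubly stochastic matrix lowers the sum of squared deviations
from the mean by the sum over the agents of the variances of the values they average
(`dispersion_sub_dispersion_mulVec`). With weights at least `θ`, such a variance is at least `θ / 2`
times the squared range of the averaged values. Sort the values at the start of a block of length
`B₀`: by strong connectivity every gap between consecutive values lies in the range averaged by some
agent at some time of the block (`exists_averaging_across_gap`), so that the block costs a fraction
`θ / (2 N²)` of the dispersion (`dispersion_block_le`). Hence the entries of the transition matrices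
differ from `1 / N` by at most `ω γ ^ m` after `m` steps (`abs_transition_sub_le`).
The states follow such an averaging iteration up to perturbations of norm at most
`G α(t + 1) / σ + 2 E(t)`: a mirror step has length at most `G α(t + 1) / σ`, and the states `x_j(t)`
lie within `d(t)` of `z_j(t)`, so that the quantizer never saturates. Variation of constants bounds
the distance of all states to common centers by a sequence whose sum over time is of the order of
`(ω / (1 - γ)) (A + N ∑ (G α / σ + 2 E))` (`sum_consensusBound_le`).

*Regret.* The subgradient at `ỹ_i(s)` is used by the mirror step from `ỹ_i(s + τ)` to
`x_i(s + τ + 1)`. The regret of `f_i` at `x_l(s + 1)` is thus bounded by the progress of this step,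
by `G` times the distance of `ỹ_i(s)` to `x_l(s + 1)`, and by `G` times the drift of `ỹ_i` during
`τ` steps (`IsAlgorithmRun.local_regret_le`). The distance and the drift are sums of mirror steps,
quantization errors and distances to consensus.

*Telescoping.* The progress terms are telescoped in the averaged divergences
`V(t) = (1/N) ∑ V_φ(x*, ỹ_i(t))` rather than in those of the states: quantization, averaging and
projection increase the potential by at most `2 L √(2 D / σ) E(t)`, and this increase is paid for
with the stepsize `α(t)` of the preceding step (`sum_potential_div_le`), which gives the terms
`E(t) / α(t)` without any assumption on the ratios `α(t) / α(t + 1)`.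
-/

/-! ### Contraction of averaging over one block -/

/-- The sum of squared deviations from the mean of the entries of `v`. -/
noncomputable def dispersion {N : ℕ} (v : Fin N → ℝ) : ℝ := ∑ i, (v i - (∑ j, v j) / N) ^ 2

theorem dispersion_nonneg {N : ℕ} (v : Fin N → ℝ) : 0 ≤ dispersion v :=
  Finset.sum_nonneg fun _ _ => sq_nonneg _

theorem dispersion_eq {N : ℕ} (v : Fin N → ℝ) :
    dispersion v = ∑ i, v i ^ 2 - (∑ j, v j) ^ 2 / N := by
  rcases Nat.eq_zero_or_pos N with rfl | hN
  · simp [dispersion]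
  have hN' : (N : ℝ) ≠ 0 := by positivity
  simp only [dispersion, sub_sq, Finset.sum_add_distrib, Finset.sum_sub_distrib]
  rw [← Finset.sum_mul, ← Finset.mul_sum]
  simp only [Finset.sum_const, Finset.card_univ, Fintype.card_fin, nsmul_eq_mul]
  field_simp
  ring

/-- One averaging step lowers the dispersion by the sum of the variances of the entries with
respect to the rows of the weight matrix. -/
theorem dispersion_sub_dispersion_mulVec {N : ℕ} {Q : Matrix (Fin N) (Fin N) ℝ}
    (hQ : Q ∈ doublyStochastic ℝ (Fin N)) (v : Fin N → ℝ) :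
    dispersion v - dispersion (Q.mulVec v)
      = ∑ i, ∑ j, Q i j * (v j - Q.mulVec v i) ^ 2 := by
  obtain ⟨-, hrow, hcol⟩ := mem_doublyStochastic_iff_sum.1 hQ
  have hsum : ∑ i, Q.mulVec v i = ∑ i, v i := by
    simp only [Matrix.mulVec, dotProduct]
    rw [Finset.sum_comm]
    simp [← Finset.sum_mul, hcol]
  have hsq : ∑ i, ∑ j, Q i j * v j ^ 2 = ∑ j, v j ^ 2 := by
    rw [Finset.sum_comm]
    simp [← Finset.sum_mul, hcol]
  have hvar : ∀ i, ∑ j, Q i j * (v j - Q.mulVec v i) ^ 2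
      = ∑ j, Q i j * v j ^ 2 - Q.mulVec v i ^ 2 := by
    intro i
    have h1 : ∑ j, Q i j * v j = Q.mulVec v i := rfl
    calc ∑ j, Q i j * (v j - Q.mulVec v i) ^ 2
        = ∑ j, (Q i j * v j ^ 2 - 2 * Q.mulVec v i * (Q i j * v j)
            + Q i j * Q.mulVec v i ^ 2) :=
          Finset.sum_congr rfl fun j _ => by ring
      _ = ∑ j, Q i j * v j ^ 2 - Q.mulVec v i ^ 2 := by
          rw [Finset.sum_add_distrib, Finset.sum_sub_distrib, ← Finset.mul_sum, h1,
            ← Finset.sum_mul, hrow]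
          ring
  rw [dispersion_eq, dispersion_eq, hsum, Finset.sum_congr rfl fun i _ => hvar i,
    Finset.sum_sub_distrib, hsq]
  ring

/-- The variance with respect to nonnegative weights controls the distance between any two values
of weight at least `θ`. -/
theorem half_mul_sq_sub_le_sum_mul_sq {ι : Type*} [Fintype ι] {p v : ι → ℝ} {θ : ℝ}
    (hp : ∀ i, 0 ≤ p i) (μ : ℝ) {a b : ι} (hθ : 0 ≤ θ) (ha : θ ≤ p a) (hb : θ ≤ p b) :
    θ / 2 * (v a - v b) ^ 2 ≤ ∑ i, p i * (v i - μ) ^ 2 := by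
  classical
  have hnn : ∀ i, 0 ≤ p i * (v i - μ) ^ 2 := fun i => mul_nonneg (hp i) (sq_nonneg _)
  by_cases hab : a = b
  · subst hab
    simpa using Finset.sum_nonneg fun i _ => hnn i
  calc θ / 2 * (v a - v b) ^ 2
      ≤ θ * (v a - μ) ^ 2 + θ * (v b - μ) ^ 2 := by
        nlinarith [mul_nonneg hθ (sq_nonneg ((v a - μ) + (v b - μ)))]
    _ ≤ p a * (v a - μ) ^ 2 + p b * (v b - μ) ^ 2 := by gcongr
    _ = ∑ i ∈ {a, b}, p i * (v i - μ) ^ 2 :=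
        (Finset.sum_pair (f := fun i => p i * (v i - μ) ^ 2) hab).symm
    _ ≤ ∑ i, p i * (v i - μ) ^ 2 :=
        Finset.sum_le_sum_of_subset_of_nonneg (Finset.subset_univ _) fun i _ _ => hnn i

/-- Disjoint gaps inside an interval have a sum of squares at most the square of its length. -/
theorem sum_sq_gaps_le {u : ℕ → ℝ} (hu : Monotone u) {n : ℕ} {K : Finset ℕ}
    (hKn : K ⊆ Finset.range n) {m M : ℝ} (hmM : m ≤ M)
    (hK : ∀ k ∈ K, m ≤ u k ∧ u (k + 1) ≤ M) :
    ∑ k ∈ K, (u (k + 1) - u k) ^ 2 ≤ (M - m) ^ 2 := by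
  have hgap : ∀ k, 0 ≤ u (k + 1) - u k := fun k => sub_nonneg.2 (hu k.le_succ)
  -- truncating the values to `[m, M]` keeps the gaps in `K` and makes all gaps telescope
  set c : ℕ → ℝ := fun k => max m (min M (u k)) with hc
  have hcmono : Monotone c := fun a b hab => max_le_max le_rfl (min_le_min le_rfl (hu hab))
  have hsum : ∑ k ∈ K, (u (k + 1) - u k) ≤ M - m := by
    calc ∑ k ∈ K, (u (k + 1) - u k) = ∑ k ∈ K, (c (k + 1) - c k) := by
          refine Finset.sum_congr rfl fun k hk => ?_
          obtain ⟨h1, h2⟩ := hK k hk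
          have h3 := hu k.le_succ
          simp only [hc]
          rw [min_eq_right h2, min_eq_right (h3.trans h2), max_eq_right h1,
            max_eq_right (h1.trans h3)]
      _ ≤ ∑ k ∈ Finset.range n, (c (k + 1) - c k) :=
          Finset.sum_le_sum_of_subset_of_nonneg hKn
            fun k _ _ => sub_nonneg.2 (hcmono k.le_succ)
      _ = c n - c 0 := Finset.sum_range_sub c n
      _ ≤ M - m := sub_le_sub (max_le hmM (min_le_left _ _)) (le_max_left _ _)
  calc ∑ k ∈ K, (u (k + 1) - u k) ^ 2 ≤ (∑ k ∈ K, (u (k + 1) - u k)) ^ 2 :=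
        Finset.sum_sq_le_sq_sum_of_nonneg fun k _ => hgap k
    _ ≤ (M - m) ^ 2 := pow_le_pow_left₀ (Finset.sum_nonneg fun k _ => hgap k) hsum 2

/-- If a gap `(lo, hi)` separates the values at the start of a block over which the union of the
graphs is strongly connected, then at some time of the block some agent averages a value below the
gap with a value above it. Otherwise the two sides of the gap would never exchange any weight. -/
theorem exists_averaging_across_gap {N : ℕ} {Q : ℕ → Matrix (Fin N) (Fin N) ℝ}
    (hQ : ∀ t, Q t ∈ doublyStochastic ℝ (Fin N)) (hdiag : ∀ t i, Q t i i ≠ 0) {a b : ℕ}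
    (hconn : ∀ u w : Fin N,
      Relation.ReflTransGen (fun j i => ∃ t, a ≤ t ∧ t < b ∧ Q t i j ≠ 0) u w)
    {v : ℕ → Fin N → ℝ} (hv : ∀ t, a ≤ t → v (t + 1) = (Q t).mulVec (v t)) {lo hi : ℝ}
    (hlohi : lo < hi) (hsplit : ∀ i, v a i ≤ lo ∨ hi ≤ v a i)
    {p q : Fin N} (hp : v a p ≤ lo) (hq : hi ≤ v a q) :
    ∃ t, a ≤ t ∧ t < b ∧ ∃ i j j', Q t i j ≠ 0 ∧ Q t i j' ≠ 0 ∧ v t j ≤ lo ∧ hi ≤ v t j' := by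
  by_contra! hno
  have hstay : ∀ m, a + m < b → ∀ i,
      (v a i ≤ lo → v (a + m) i ≤ lo) ∧ (hi ≤ v a i → hi ≤ v (a + m) i) := by
    intro m
    induction m with
    | zero => exact fun _ i => ⟨id, id⟩
    | succ m ih =>
      intro hm i
      have hm' : a + m < b := by omega
      obtain ⟨hnn, hrow, -⟩ := mem_doublyStochastic_iff_sum.1 (hQ (a + m))
      have hsplit' : ∀ j, v (a + m) j ≤ lo ∨ hi ≤ v (a + m) j := fun j =>
        (hsplit j).imp (ih hm' j).1 (ih hm' j).2
      have hstep : v (a + (m + 1)) i = ∑ j, Q (a + m) i j * v (a + m) j := by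
        rw [← add_assoc, hv _ (by omega)]
        rfl
      have hno' := hno (a + m) (by omega) hm' i
      constructor
      · intro hi'
        calc v (a + (m + 1)) i = ∑ j, Q (a + m) i j * v (a + m) j := hstep
          _ ≤ ∑ j, Q (a + m) i j * lo := by
              refine Finset.sum_le_sum fun j _ => ?_
              by_cases h0 : Q (a + m) i j = 0
              · simp [h0]
              refine mul_le_mul_of_nonneg_left ((hsplit' j).resolve_right fun h => ?_) (hnn i j)
              exact absurd h (not_le.2 (hno' i j (hdiag _ i) h0 ((ih hm' i).1 hi')))
          _ = lo := by rw [← Finset.sum_mul, hrow, one_mul]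
      · intro hi'
        calc hi = ∑ j, Q (a + m) i j * hi := by rw [← Finset.sum_mul, hrow, one_mul]
          _ ≤ ∑ j, Q (a + m) i j * v (a + m) j := by
              refine Finset.sum_le_sum fun j _ => ?_
              by_cases h0 : Q (a + m) i j = 0
              · simp [h0]
              refine mul_le_mul_of_nonneg_left ((hsplit' j).resolve_left fun h => ?_) (hnn i j)
              exact absurd ((ih hm' i).2 hi') (not_le.2 (hno' j i h0 (hdiag _ i) h))
          _ = v (a + (m + 1)) i := hstep.symm
  have hreach : ∀ w, v a w ≤ lo := by
    intro w
    induction hconn p w with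
    | refl => exact hp
    | tail _ hedge ih =>
      obtain ⟨t, hat, htb, hne⟩ := hedge
      obtain ⟨m, rfl⟩ := Nat.exists_eq_add_of_le hat
      rename_i j i _
      refine (hsplit i).resolve_right fun h => ?_
      have hj := (hstay m htb j).1 ih
      have hi' := (hstay m htb i).2 h
      exact absurd hi' (not_le.2 (hno _ hat htb i j i hne (hdiag _ i) hj))
  linarith [hreach q]

/-- Contraction of the dispersion over a block whose union graph is strongly connected. Every gap
between consecutive values at the start of the block is bridged by some agent at some time, so
`θ / 2 · ∑ gap²` is lost; the initial dispersion is at most `N² ∑ gap²`. -/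
theorem dispersion_block_le {N : ℕ} (hN : 0 < N) {Q : ℕ → Matrix (Fin N) (Fin N) ℝ}
    (hQ : ∀ t, Q t ∈ doublyStochastic ℝ (Fin N)) {θ : ℝ} (hθ : 0 < θ)
    (hedge : ∀ t i j, Q t i j ≠ 0 → θ ≤ Q t i j) (hdiag : ∀ t i, θ ≤ Q t i i) {a b : ℕ}
    (hab : a ≤ b)
    (hconn : ∀ u w : Fin N,
      Relation.ReflTransGen (fun j i => ∃ t, a ≤ t ∧ t < b ∧ Q t i j ≠ 0) u w)
    {v : ℕ → Fin N → ℝ} (hv : ∀ t, a ≤ t → v (t + 1) = (Q t).mulVec (v t)) :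
    dispersion (v b) ≤ (1 - θ / (2 * (N : ℝ) ^ 2)) * dispersion (v a) := by
  classical
  have hN' : (0 : ℝ) < N := by exact_mod_cast hN
  have hdiag0 : ∀ t i, Q t i i ≠ 0 := fun t i => (hθ.trans_le (hdiag t i)).ne'
  -- the values at the start of the block in increasing order, constant from index `N - 1` on
  set π := Tuple.sort (v a) with hπ
  set u : ℕ → ℝ := fun k => v a (π ⟨min k (N - 1), by omega⟩) with hu
  have humono : Monotone u := fun k k' hk => by
    refine Tuple.monotone_sort (v a) (?_ : (⟨_, _⟩ : Fin N) ≤ ⟨_, _⟩)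
    exact Fin.mk_le_mk.2 (min_le_min hk le_rfl)
  have hidx : ∀ i, v a i = u (π.symm i) := fun i => by
    have h : min ((π.symm i : Fin N) : ℕ) (N - 1) = π.symm i := by omega
    simp [hu, h]
  set gap : ℕ → ℝ := fun k => u (k + 1) - u k with hgap
  -- the gaps that the neighborhood of agent `i` bridges at time `t`
  set K : ℕ → Fin N → Finset ℕ := fun t i => (Finset.range (N - 1)).filter fun k =>
    ∃ j j', Q t i j ≠ 0 ∧ Q t i j' ≠ 0 ∧ v t j ≤ u k ∧ u (k + 1) ≤ v t j' with hK
  have hlocal : ∀ t i, θ / 2 * ∑ k ∈ K t i, gap k ^ 2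
      ≤ ∑ j, Q t i j * (v t j - (Q t).mulVec (v t) i) ^ 2 := by
    intro t i
    have hne : (Finset.univ.filter fun j => Q t i j ≠ 0).Nonempty := ⟨i, by simp [hdiag0]⟩
    obtain ⟨jM, hjM, hM⟩ := Finset.exists_max_image _ (v t) hne
    obtain ⟨jm, hjm, hm⟩ := Finset.exists_min_image _ (v t) hne
    simp only [Finset.mem_filter, Finset.mem_univ, true_and] at hjM hM hjm hm
    refine le_trans (mul_le_mul_of_nonneg_left ?_ (by positivity))
      (half_mul_sq_sub_le_sum_mul_sq (p := Q t i) (v := v t)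
        (fun j => (mem_doublyStochastic_iff_sum.1 (hQ t)).1 i j) _ hθ.le
        (hedge _ _ _ hjM) (hedge _ _ _ hjm))
    refine sum_sq_gaps_le humono (Finset.filter_subset _ _) (hm jM hjM) fun k hk => ?_
    obtain ⟨-, j, j', hj, hj', h1, h2⟩ := Finset.mem_filter.1 hk
    exact ⟨(hm j hj).trans h1, h2.trans (hM j' hj')⟩
  have hcover : ∀ k ∈ Finset.range (N - 1),
      gap k ^ 2 ≤ ∑ t ∈ Finset.Ico a b, ∑ i, if k ∈ K t i then gap k ^ 2 else 0 := by
    intro k hk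
    have hkN : k + 1 ≤ N - 1 := by have := Finset.mem_range.1 hk; omega
    have hnn : ∀ t i, 0 ≤ (if k ∈ K t i then gap k ^ 2 else 0 : ℝ) := fun t i => by
      split_ifs <;> positivity
    rcases (humono k.le_succ).eq_or_lt with heq | hlt
    · have h0 : gap k = 0 := by simp only [hgap]; rw [← Nat.succ_eq_add_one, ← heq, sub_self]
      simp [h0]
    · obtain ⟨t, hat, htb, i, j, j', h⟩ := exists_averaging_across_gap hQ hdiag0 hconn hv hlt
        (p := π ⟨min k (N - 1), by omega⟩) (q := π ⟨min (k + 1) (N - 1), by omega⟩)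
        (fun i => by
          rw [hidx i]
          rcases Nat.lt_or_ge k (π.symm i) with h | h
          · exact Or.inr (humono h)
          · exact Or.inl (humono h)) le_rfl le_rfl
      have hmem : k ∈ K t i := Finset.mem_filter.2 ⟨hk, j, j', h⟩
      calc gap k ^ 2 = if k ∈ K t i then gap k ^ 2 else 0 := by rw [if_pos hmem]
        _ ≤ ∑ i, if k ∈ K t i then gap k ^ 2 else 0 :=
            Finset.single_le_sum (f := fun i => if k ∈ K t i then gap k ^ 2 else 0)
              (fun i _ => hnn t i) (Finset.mem_univ i)
        _ ≤ _ := Finset.single_le_sum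
              (f := fun t => ∑ i, if k ∈ K t i then gap k ^ 2 else 0)
              (fun t _ => Finset.sum_nonneg fun i _ => hnn t i) (Finset.mem_Ico.2 ⟨hat, htb⟩)
  have hloss : ∑ t ∈ Finset.Ico a b, ∑ i, ∑ j, Q t i j * (v t j - (Q t).mulVec (v t) i) ^ 2
      = dispersion (v a) - dispersion (v b) := by
    rw [← neg_sub (dispersion (v b)), ← Finset.sum_Ico_sub (fun t => dispersion (v t)) hab,
      ← Finset.sum_neg_distrib]
    refine Finset.sum_congr rfl fun t ht => ?_
    rw [hv t (Finset.mem_Ico.1 ht).1, neg_sub, dispersion_sub_dispersion_mulVec (hQ t)]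
  have hgaps : θ / 2 * ∑ k ∈ Finset.range (N - 1), gap k ^ 2
      ≤ dispersion (v a) - dispersion (v b) := by
    rw [← hloss]
    calc θ / 2 * ∑ k ∈ Finset.range (N - 1), gap k ^ 2
        ≤ θ / 2 * ∑ k ∈ Finset.range (N - 1),
            ∑ t ∈ Finset.Ico a b, ∑ i, if k ∈ K t i then gap k ^ 2 else 0 :=
          mul_le_mul_of_nonneg_left (Finset.sum_le_sum hcover) (by positivity)
      _ = ∑ t ∈ Finset.Ico a b, ∑ i, θ / 2 * ∑ k ∈ K t i, gap k ^ 2 := by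
          rw [Finset.sum_comm, Finset.mul_sum]
          refine Finset.sum_congr rfl fun t _ => ?_
          rw [Finset.sum_comm, Finset.mul_sum]
          refine Finset.sum_congr rfl fun i _ => ?_
          rw [← Finset.sum_filter]
          congr 1
          refine Finset.sum_congr ?_ fun _ _ => rfl
          ext k
          rw [Finset.mem_filter, and_iff_right_iff_imp]
          exact fun hk => (Finset.mem_filter.1 hk).1
      _ ≤ _ := Finset.sum_le_sum fun t _ => Finset.sum_le_sum fun i _ => hlocal t i
  -- all entries lie between `u 0` and `u (N - 1)`, and so does their mean
  have hrange : ∀ i, u 0 ≤ v a i ∧ v a i ≤ u (N - 1) := fun i => by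
    rw [hidx i]
    exact ⟨humono (Nat.zero_le _), humono (by omega)⟩
  have hmean : u 0 ≤ (∑ j, v a j) / N ∧ (∑ j, v a j) / N ≤ u (N - 1) := by
    have h1 := Finset.card_nsmul_le_sum Finset.univ (v a) (u 0) fun i _ => (hrange i).1
    have h2 := Finset.sum_le_card_nsmul Finset.univ (v a) (u (N - 1)) fun i _ => (hrange i).2
    simp only [Finset.card_univ, Fintype.card_fin, nsmul_eq_mul] at h1 h2
    constructor
    · rw [le_div_iff₀ hN']; linarith
    · rw [div_le_iff₀ hN']; linarith
  have hwidth : u (N - 1) - u 0 = ∑ k ∈ Finset.range (N - 1), gap k :=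
    (Finset.sum_range_sub u (N - 1)).symm
  have hG0 : 0 ≤ ∑ k ∈ Finset.range (N - 1), gap k ^ 2 := Finset.sum_nonneg fun _ _ => sq_nonneg _
  have hwidth2 : (u (N - 1) - u 0) ^ 2 ≤ N * ∑ k ∈ Finset.range (N - 1), gap k ^ 2 := by
    rw [hwidth]
    refine sq_sum_le_card_mul_sum_sq.trans (mul_le_mul_of_nonneg_right ?_ hG0)
    rw [Finset.card_range]
    exact_mod_cast Nat.sub_le N 1
  have hdisp : dispersion (v a) ≤ (N : ℝ) ^ 2 * ∑ k ∈ Finset.range (N - 1), gap k ^ 2 := by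
    calc dispersion (v a) ≤ ∑ _i : Fin N, (u (N - 1) - u 0) ^ 2 := by
          refine Finset.sum_le_sum fun i _ => sq_le_sq' ?_ ?_ <;>
            linarith [hrange i, hmean.1, hmean.2, (hrange i).1, (hrange i).2]
      _ = N * (u (N - 1) - u 0) ^ 2 := by simp
      _ ≤ N * (N * ∑ k ∈ Finset.range (N - 1), gap k ^ 2) := by gcongr
      _ = _ := by ring
  have hfrac : θ / (2 * (N : ℝ) ^ 2) * dispersion (v a)
      ≤ θ / 2 * ∑ k ∈ Finset.range (N - 1), gap k ^ 2 := by
    calc θ / (2 * (N : ℝ) ^ 2) * dispersion (v a)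
        ≤ θ / (2 * (N : ℝ) ^ 2) * ((N : ℝ) ^ 2 * ∑ k ∈ Finset.range (N - 1), gap k ^ 2) := by
          gcongr
      _ = _ := by field_simp
  linarith

/-! ### Transition matrices -/

/-- The product `P (s + m - 1) ⋯ P s` of `m` consecutive weight matrices from time `s` on. -/
def transition {N : ℕ} (P : ℕ → Matrix (Fin N) (Fin N) ℝ) (s : ℕ) : ℕ → Matrix (Fin N) (Fin N) ℝ
  | 0 => 1
  | m + 1 => P (s + m) * transition P s m

theorem transition_succ {N : ℕ} (P : ℕ → Matrix (Fin N) (Fin N) ℝ) (s m : ℕ) :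
    transition P s (m + 1) = P (s + m) * transition P s m := rfl

theorem transition_mem_doublyStochastic {N : ℕ} {P : ℕ → Matrix (Fin N) (Fin N) ℝ}
    (hP : ∀ t, P t ∈ doublyStochastic ℝ (Fin N)) (s m : ℕ) :
    transition P s m ∈ doublyStochastic ℝ (Fin N) := by
  induction m with
  | zero => exact one_mem _
  | succ m ih => exact mul_mem (hP _) ih

/-- `1 - θ / (4 N²)`, the contraction factor over one block of the Euclidean distance to
consensus; `γ` is its `B₀`-th root and `ω` the inverse of its square. -/
noncomputable def blockFactor (N : ℕ) (θ : ℝ) : ℝ := 1 - θ / (4 * (N : ℝ) ^ 2)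

theorem blockFactor_pos {N : ℕ} (hN : 0 < N) {θ : ℝ} (hθ1 : θ < 1) : 0 < blockFactor N θ := by
  have hN' : (1 : ℝ) ≤ N := by exact_mod_cast hN
  rw [blockFactor, sub_pos, div_lt_one (by positivity)]
  nlinarith

theorem blockFactor_lt_one {N : ℕ} (hN : 0 < N) {θ : ℝ} (hθ : 0 < θ) : blockFactor N θ < 1 := by
  have hN' : (0 : ℝ) < N := by exact_mod_cast hN
  rw [blockFactor, sub_lt_self_iff]
  positivity

theorem gammaConst_pos {N : ℕ} (hN : 0 < N) {θ : ℝ} (hθ1 : θ < 1) (B₀ : ℕ) :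
    0 < gammaConst N B₀ θ :=
  Real.rpow_pos_of_pos (blockFactor_pos hN hθ1) _

theorem gammaConst_pow {N : ℕ} (hN : 0 < N) {θ : ℝ} (hθ1 : θ < 1) {B₀ : ℕ} (hB₀ : 1 ≤ B₀) :
    gammaConst N B₀ θ ^ B₀ = blockFactor N θ := by
  rw [gammaConst, one_div]
  exact Real.rpow_inv_natCast_pow (blockFactor_pos hN hθ1).le (by omega)

theorem gammaConst_lt_one {N : ℕ} (hN : 0 < N) {θ : ℝ} (hθ : 0 < θ) (hθ1 : θ < 1) {B₀ : ℕ}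
    (hB₀ : 1 ≤ B₀) : gammaConst N B₀ θ < 1 := by
  refine Real.rpow_lt_one (blockFactor_pos hN hθ1).le (blockFactor_lt_one hN hθ) ?_
  have : (0 : ℝ) < B₀ := by exact_mod_cast hB₀
  positivity

theorem omegaConst_pos {N : ℕ} (hN : 0 < N) {θ : ℝ} (hθ1 : θ < 1) : 0 < omegaConst N θ :=
  inv_pos.2 (pow_pos (blockFactor_pos hN hθ1) 2)

/-- A column of a transition matrix evolves by averaging, so its dispersion, at most `1` initially,
shrinks by the square of the block factor over every complete block. Fewer than two block lengths
are lost at the two ends of the time window, which accounts for the factor `ω`. -/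
theorem abs_transition_sub_le {N : ℕ} {P : ℕ → Matrix (Fin N) (Fin N) ℝ}
    (hP : ∀ t, P t ∈ doublyStochastic ℝ (Fin N)) {B₀ : ℕ} {θ : ℝ} (hconn : IsBConnected P B₀ θ)
    (s m : ℕ) (i j : Fin N) :
    |transition P s m i j - 1 / N| ≤ omegaConst N θ * gammaConst N B₀ θ ^ m := by
  have hN : 0 < N := i.pos
  have hN' : (0 : ℝ) < N := by exact_mod_cast hN
  have hB₀ := hconn.block_pos
  set ρ := blockFactor N θ with hρ
  set γ := gammaConst N B₀ θ with hγ
  have hρ0 : 0 < ρ := blockFactor_pos hN hconn.theta_lt_one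
  have hγ0 : 0 < γ := gammaConst_pos hN hconn.theta_lt_one B₀
  have hγ1 : γ < 1 := gammaConst_lt_one hN hconn.theta_pos hconn.theta_lt_one hB₀
  have hγρ : γ ^ B₀ = ρ := gammaConst_pow hN hconn.theta_lt_one hB₀
  -- the column, indexed by absolute time
  set v : ℕ → Fin N → ℝ := fun t r => transition P s (t - s) r j with hv
  have hstep : ∀ t, s ≤ t → v (t + 1) = (P t).mulVec (v t) := by
    intro t ht
    obtain ⟨k, rfl⟩ := Nat.exists_eq_add_of_le ht
    funext r
    simp only [hv, add_tsub_cancel_left, add_assoc, transition_succ]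
    rfl
  have hdec : ∀ t, s ≤ t → dispersion (v (t + 1)) ≤ dispersion (v t) := by
    intro t ht
    rw [hstep t ht, ← sub_nonneg, dispersion_sub_dispersion_mulVec (hP t)]
    exact Finset.sum_nonneg fun a _ => Finset.sum_nonneg fun b _ =>
      mul_nonneg ((mem_doublyStochastic_iff_sum.1 (hP t)).1 a b) (sq_nonneg _)
  have hanti : ∀ t k, s ≤ t → dispersion (v (t + k)) ≤ dispersion (v t) := by
    intro t k ht
    induction k with
    | zero => exact le_rfl
    | succ k ih => exact (hdec (t + k) (by omega)).trans ih
  have hinit : dispersion (v s) ≤ 1 := by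
    rw [dispersion_eq]
    have h0 : ∀ r, v s r = if r = j then 1 else 0 := fun r => by
      simp [hv, transition, Matrix.one_apply]
    simp only [h0, ite_pow, one_pow, zero_pow two_ne_zero, Finset.sum_ite_eq', Finset.mem_univ,
      if_true]
    linarith [show (0 : ℝ) ≤ 1 / N by positivity]
  have hblock : ∀ c, s ≤ c * B₀ + 1 →
      dispersion (v ((c + 1) * B₀ + 1)) ≤ ρ ^ 2 * dispersion (v (c * B₀ + 1)) := by
    intro c hc
    refine (dispersion_block_le hN hP hconn.theta_pos hconn.edge_weight hconn.diag_weight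
      (a := c * B₀ + 1) (by nlinarith) (fun u w => ?_) (fun t ht => hstep t (hc.trans ht))).trans ?_
    · refine Relation.ReflTransGen.mono (?_ : _ ≤ _) u w (hconn.strongly_connected c u w)
      rintro a b ⟨t, h1, h2, h3⟩
      exact ⟨t, h1, Nat.lt_succ_of_le h2, h3⟩
    · refine mul_le_mul_of_nonneg_right ?_ (dispersion_nonneg _)
      have h1 : θ / (2 * (N : ℝ) ^ 2) = 2 * (θ / (4 * (N : ℝ) ^ 2)) := by field_simp; ring
      rw [h1, hρ, blockFactor]
      nlinarith [sq_nonneg (θ / (4 * (N : ℝ) ^ 2))]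
  set c₀ := s / B₀ + 1 with hc₀
  have hc₀s : s ≤ c₀ * B₀ + 1 := by
    have := Nat.lt_div_mul_add (a := s) (b := B₀) hB₀
    rw [hc₀, add_mul]; omega
  have hc₀u : c₀ * B₀ ≤ s + B₀ := by
    have := Nat.div_mul_le_self s B₀
    rw [hc₀, add_mul]; omega
  have hblocks : ∀ q, dispersion (v ((c₀ + q) * B₀ + 1)) ≤ (ρ ^ q) ^ 2 := by
    intro q
    induction q with
    | zero =>
      obtain ⟨k, hk⟩ := Nat.exists_eq_add_of_le hc₀s
      simpa [hk] using (hanti s k le_rfl).trans hinit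
    | succ q ih =>
      have h := hblock (c₀ + q) (hc₀s.trans (by gcongr; omega))
      calc dispersion (v ((c₀ + (q + 1)) * B₀ + 1))
          ≤ ρ ^ 2 * dispersion (v ((c₀ + q) * B₀ + 1)) := h
        _ ≤ ρ ^ 2 * (ρ ^ q) ^ 2 := by gcongr
        _ = (ρ ^ (q + 1)) ^ 2 := by ring
  have hfinal : ∃ q, m ≤ (q + 2) * B₀ ∧ dispersion (v (s + m)) ≤ (ρ ^ q) ^ 2 := by
    rcases Nat.lt_or_ge (s + m) (c₀ * B₀ + 1) with h | h
    · exact ⟨0, by omega, by simpa using (hanti s m le_rfl).trans hinit⟩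
    · obtain ⟨k, hk⟩ := Nat.exists_eq_add_of_le h
      have hkdiv := Nat.div_add_mod k B₀
      have hkmod := Nat.mod_lt k hB₀
      rw [mul_comm] at hkdiv
      refine ⟨k / B₀, ?_, ?_⟩
      · rw [add_mul]; omega
      · have h1 : s + m = ((c₀ + k / B₀) * B₀ + 1) + k % B₀ := by
          rw [hk, add_mul c₀]; omega
        rw [h1]
        exact (hanti _ _ (hc₀s.trans (by gcongr; exact Nat.le_add_right _ _))).trans (hblocks _)
  obtain ⟨q, hmq, hq⟩ := hfinal
  have hmean : ∑ r, v (s + m) r = 1 := by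
    simpa [hv] using (mem_doublyStochastic_iff_sum.1 (transition_mem_doublyStochastic hP s m)).2.2 j
  have hentry : (transition P s m i j - 1 / N) ^ 2 ≤ (ρ ^ q) ^ 2 := by
    refine le_trans ?_ hq
    have h := Finset.single_le_sum (f := fun r => (v (s + m) r - 1 / (N : ℝ)) ^ 2)
      (fun r _ => sq_nonneg _) (Finset.mem_univ i)
    rw [dispersion, hmean]
    simpa [hv] using h
  calc |transition P s m i j - 1 / N| ≤ ρ ^ q := abs_le_of_sq_le_sq hentry (by positivity)
    _ = omegaConst N θ * γ ^ ((q + 2) * B₀) := by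
        have h1 : omegaConst N θ = (ρ ^ 2)⁻¹ := rfl
        rw [h1, mul_comm (q + 2), pow_mul, hγρ]
        field_simp
        ring
    _ ≤ omegaConst N θ * γ ^ m :=
        mul_le_mul_of_nonneg_left (pow_le_pow_of_le_one hγ0.le hγ1.le hmq)
          (omegaConst_pos hN hconn.theta_lt_one).le

/-! ### Perturbed averaging -/

section Consensus

variable {E : Type*} [NormedAddCommGroup E] [NormedSpace ℝ E] {N : ℕ}

/-- Variation of constants for a perturbed averaging iteration. -/
theorem perturbed_averaging_eq {P : ℕ → Matrix (Fin N) (Fin N) ℝ} {x u : Fin N → ℕ → E}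
    (hx : ∀ i t, x i (t + 1) = ∑ j, P t i j • x j t + u i t) (t : ℕ) (i : Fin N) :
    x i t = ∑ j, transition P 0 t i j • x j 0
      + ∑ k ∈ Finset.range t, ∑ j, transition P (k + 1) (t - 1 - k) i j • u j k := by
  have hmul : ∀ (s m : ℕ) (i : Fin N) (w : Fin N → E),
      ∑ j, P (s + m) i j • ∑ r, transition P s m j r • w r
        = ∑ r, transition P s (m + 1) i r • w r := by
    intro s m i w
    simp only [Finset.smul_sum, smul_smul, transition_succ, Matrix.mul_apply, Finset.sum_smul]
    exact Finset.sum_comm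
  induction t generalizing i with
  | zero => simp [transition, Matrix.one_apply]
  | succ t ih =>
    have hlast : ∑ j, transition P (t + 1) (t + 1 - 1 - t) i j • u j t = u i t := by
      simp [transition, Matrix.one_apply]
    rw [hx, Finset.sum_range_succ, hlast, ← add_assoc]
    congr 1
    calc ∑ j, P t i j • x j t
        = ∑ j, (P t i j • ∑ r, transition P 0 t j r • x r 0
          + ∑ k ∈ Finset.range t,
              P t i j • ∑ r, transition P (k + 1) (t - 1 - k) j r • u r k) := by
          refine Finset.sum_congr rfl fun j _ => ?_
          rw [ih j, smul_add, Finset.smul_sum (s := Finset.range t)]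
      _ = _ := by
          rw [Finset.sum_add_distrib, Finset.sum_comm (s := Finset.univ) (t := Finset.range t)]
          congr 1
          · simpa using hmul 0 t i fun r => x r 0
          · refine Finset.sum_congr rfl fun k hk => ?_
            have hk' := Finset.mem_range.1 hk
            have h := hmul (k + 1) (t - 1 - k) i fun r => u r k
            rwa [show k + 1 + (t - 1 - k) = t by omega,
              show t - 1 - k + 1 = t + 1 - 1 - k by omega] at h

/-- Approximate consensus: the agents stay close to common centers (the averages of the states). -/
theorem exists_consensus_centers {P : ℕ → Matrix (Fin N) (Fin N) ℝ}
    (hP : ∀ t, P t ∈ doublyStochastic ℝ (Fin N)) {B₀ : ℕ} {θ : ℝ} (hconn : IsBConnected P B₀ θ)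
    {x u : Fin N → ℕ → E} (hx : ∀ i t, x i (t + 1) = ∑ j, P t i j • x j t + u i t) :
    ∃ c : ℕ → E, ∀ t i, ‖x i t - c t‖ ≤
      omegaConst N θ * gammaConst N B₀ θ ^ t * ∑ j, ‖x j 0‖
        + ∑ k ∈ Finset.range t,
            omegaConst N θ * gammaConst N B₀ θ ^ (t - 1 - k) * ∑ j, ‖u j k‖ := by
  refine ⟨fun t => ∑ j, (1 / (N : ℝ)) • x j 0
    + ∑ k ∈ Finset.range t, ∑ j, (1 / (N : ℝ)) • u j k, fun t i => ?_⟩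
  have hcol : ∀ (s m : ℕ) (w : Fin N → E),
      ‖∑ j, transition P s m i j • w j - ∑ j, (1 / (N : ℝ)) • w j‖
        ≤ omegaConst N θ * gammaConst N B₀ θ ^ m * ∑ j, ‖w j‖ := by
    intro s m w
    rw [← Finset.sum_sub_distrib, Finset.mul_sum]
    refine norm_sum_le_of_le _ fun j _ => ?_
    rw [← sub_smul, norm_smul, Real.norm_eq_abs]
    exact mul_le_mul_of_nonneg_right (abs_transition_sub_le hP hconn s m i j) (norm_nonneg _)
  rw [perturbed_averaging_eq hx t i, add_sub_add_comm, ← Finset.sum_sub_distrib (s := Finset.range t)]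
  exact norm_add_le_of_le (hcol 0 t fun j => x j 0) (norm_sum_le_of_le _ fun k _ => hcol (k + 1) _ fun j => u j k)

end Consensus

/-! ### The quantizer -/

section Quantizer

/-- A point of the quantization interval lies in a cell of width `2 d / K` whose left end is the
quantized value; the right end `z + d` of the interval is quantized exactly. For `K = 1` the error
can come arbitrarily close to `2 d`. -/
theorem abs_quantize_sub_le {K : ℕ} (hK : 1 ≤ K) {z d x : ℝ} (hxz : |x - z| ≤ d) :
    |quantize K z d x - x| ≤ 2 * d := by
  have hd : 0 ≤ d := (abs_nonneg _).trans hxz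
  obtain ⟨h1, h2⟩ := abs_le.1 hxz
  have hK' : (1 : ℝ) ≤ K := by exact_mod_cast hK
  rw [quantize, if_neg (not_lt.2 h1)]
  split_ifs with h
  · rw [abs_le]; constructor <;> linarith
  · have hd' : 0 < d := by
      rw [not_le] at h
      exact hd.lt_of_ne fun h0 => by linarith
    set r := (x - z + d) * K / (2 * d) with hr
    have hx : x = z - d + r * (2 * d / K) := by rw [hr]; field_simp; ring
    have hq : z + (2 * (⌊r⌋ : ℝ) - K) * d / K - x = -((r - ⌊r⌋) * (2 * d / K)) := by
      rw [hx]; field_simp; ring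
    have hf0 := Int.fract_nonneg r
    have hf1 := (Int.fract_lt_one r).le
    rw [Int.fract] at hf0 hf1
    rw [hq, abs_neg, abs_of_nonneg (by positivity)]
    calc (r - ⌊r⌋) * (2 * d / K) ≤ 1 * (2 * d / 1) := by gcongr
      _ = 2 * d := by ring

/-- The Euclidean error of the quantizer is at most `2 √n r`, which is bounded by `2 n r` to match
the form of `E(t)`. -/
theorem norm_quantizeVec_sub_le {n K : ℕ} (hK : 1 ≤ K) {z d x : EuclideanSpace ℝ (Fin n)} {r : ℝ}
    (hr : 0 ≤ r) (hd : ∀ k, d k = r) (hxz : ‖x - z‖ ≤ r) :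
    ‖quantizeVec K z d x - x‖ ≤ 2 * (n * r) := by
  have hcoord : ∀ k, ‖(quantizeVec K z d x - x) k‖ ≤ 2 * r := fun k => by
    have h : |x k - z k| ≤ d k := by
      rw [hd k]
      exact (PiLp.norm_apply_le (x - z) k).trans hxz
    have h' := abs_quantize_sub_le hK h
    rw [hd k] at h'
    simpa [quantizeVec, hd k] using h'
  have hsq : ‖quantizeVec K z d x - x‖ ^ 2 ≤ (2 * (n * r)) ^ 2 := by
    rw [EuclideanSpace.norm_sq_eq]
    calc ∑ k, ‖(quantizeVec K z d x - x) k‖ ^ 2 ≤ ∑ _k : Fin n, (2 * r) ^ 2 := by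
          gcongr with k; exact hcoord k
      _ = n * (2 * r) ^ 2 := by simp
      _ ≤ (n : ℝ) ^ 2 * (2 * r) ^ 2 := by
          gcongr
          exact_mod_cast Nat.le_self_pow two_ne_zero n
      _ = (2 * (n * r)) ^ 2 := by ring
  exact le_of_sq_le_sq hsq (by positivity)

end Quantizer

/-! ### Projections onto convex sets -/

section Projection

variable {n : ℕ} {X : Set (EuclideanSpace ℝ (Fin n))}

/-- Projecting onto a convex set does not increase the distance to a point of the set. -/
theorem norm_proj_sub_le (hX : Convex ℝ X) {y w : EuclideanSpace ℝ (Fin n)}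
    (hw : IsArgminOn X (fun u => ‖u - y‖) w) {p : EuclideanSpace ℝ (Fin n)} (hp : p ∈ X) :
    ‖w - p‖ ≤ ‖y - p‖ := by
  obtain ⟨hwX, hmin⟩ := hw
  have hinf : ‖y - w‖ = ⨅ u : X, ‖y - u‖ := by
    have : Nonempty X := ⟨⟨w, hwX⟩⟩
    refine le_antisymm (le_ciInf fun u => ?_) (ciInf_le ⟨0, ?_⟩ (⟨w, hwX⟩ : X))
    · simpa only [norm_sub_rev y] using isMinOn_iff.1 hmin u u.2
    · rintro _ ⟨u, rfl⟩
      exact norm_nonneg _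
  have hobt := (norm_eq_iInf_iff_real_inner_le_zero hX hwX).1 hinf p hp
  have hsplit : ‖y - p‖ ^ 2 = ‖y - w‖ ^ 2 + 2 * inner ℝ (y - w) (w - p) + ‖w - p‖ ^ 2 := by
    rw [← norm_add_sq_real, sub_add_sub_cancel]
  have hneg : inner ℝ (y - w) (w - p) = -inner ℝ (y - w) (p - w) := by
    rw [← inner_neg_right, neg_sub]
  refine le_of_sq_le_sq ?_ (norm_nonneg _)
  nlinarith [sq_nonneg ‖y - w‖]

end Projection

/-! ### Bregman divergences and mirror steps -/

section MirrorStep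

variable {n : ℕ} {X : Set (EuclideanSpace ℝ (Fin n))} {φ : EuclideanSpace ℝ (Fin n) → ℝ}
  {σ L : ℝ} {g w y : EuclideanSpace ℝ (Fin n)} {s : ℝ}

theorem half_mul_sq_le_bregman
    (hsc : ∀ a b, φ a + inner ℝ (gradient φ a) (b - a) + σ / 2 * ‖b - a‖ ^ 2 ≤ φ b) (a b) :
    σ / 2 * ‖a - b‖ ^ 2 ≤ bregman φ a b := by
  rw [bregman]
  linarith [hsc b a]

theorem mul_sq_le_inner_gradient_sub
    (hsc : ∀ a b, φ a + inner ℝ (gradient φ a) (b - a) + σ / 2 * ‖b - a‖ ^ 2 ≤ φ b) (a b) :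
    σ * ‖a - b‖ ^ 2 ≤ inner ℝ (gradient φ a - gradient φ b) (a - b) := by
  have h1 := hsc a b
  have h2 := hsc b a
  rw [norm_sub_rev, ← neg_sub a b, inner_neg_right] at h1
  rw [inner_sub_left]
  linarith

/-- The three point identity. -/
theorem bregman_three_point (p w y : EuclideanSpace ℝ (Fin n)) :
    bregman φ p y - bregman φ p w - bregman φ w y
      = inner ℝ (gradient φ w - gradient φ y) (p - w) := by
  have h : inner ℝ (gradient φ y) (p - y)
      = inner ℝ (gradient φ y) (p - w) + inner ℝ (gradient φ y) (w - y) := by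
    rw [← inner_add_right, sub_add_sub_cancel]
  rw [bregman, bregman, bregman, inner_sub_left, h]
  ring

/-- Moving the second argument of the divergence from `b` to `w` costs at most
`L ‖b - w‖ ‖a - w‖`: in the three point identity the divergence of `w` and `b` has the good sign. -/
theorem bregman_le_bregman_add (hσ : 0 ≤ σ)
    (hsc : ∀ a b, φ a + inner ℝ (gradient φ a) (b - a) + σ / 2 * ‖b - a‖ ^ 2 ≤ φ b)
    (hL : ∀ a b, ‖gradient φ a - gradient φ b‖ ≤ L * ‖a - b‖) (a b w) :
    bregman φ a w ≤ bregman φ a b + L * ‖b - w‖ * ‖a - w‖ := by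
  have h3 := bregman_three_point (φ := φ) a w b
  have hnn : 0 ≤ bregman φ w b :=
    (by positivity : 0 ≤ σ / 2 * ‖w - b‖ ^ 2).trans (half_mul_sq_le_bregman hsc w b)
  have hcs : -(inner ℝ (gradient φ w - gradient φ b) (a - w)) ≤ L * ‖b - w‖ * ‖a - w‖ := by
    rw [← inner_neg_left, neg_sub]
    exact (real_inner_le_norm _ _).trans (mul_le_mul_of_nonneg_right (hL b w) (norm_nonneg _))
  linarith

/-- First order optimality condition of a mirror descent step with stepsize `s`. -/
theorem mirror_step_optimality (hφ : ContDiff ℝ 1 φ) (hX : Convex ℝ X) (hs : 0 < s)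
    (hw : IsArgminOn X (fun u => inner ℝ g u + bregman φ u y / s) w)
    {p : EuclideanSpace ℝ (Fin n)} (hp : p ∈ X) :
    0 ≤ s * inner ℝ g (p - w) + inner ℝ (gradient φ w - gradient φ y) (p - w) := by
  have hφw : HasFDerivAt φ (innerSL ℝ (gradient φ w)) w :=
    ((hφ.differentiable one_ne_zero) w).hasGradientAt.hasFDerivAt
  have hlin : HasFDerivAt (fun u => inner ℝ (gradient φ y) (u - y)) (innerSL ℝ (gradient φ y)) w :=
    (innerSL ℝ (gradient φ y)).hasFDerivAt.comp w ((hasFDerivAt_id w).sub_const y)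
  have hder := ((innerSL ℝ g).hasFDerivAt (x := w)).add
    (((hφw.sub_const (φ y)).sub hlin).const_smul s⁻¹)
  have hmin : IsMinOn (fun u => innerSL ℝ g u
      + s⁻¹ • (φ u - φ y - inner ℝ (gradient φ y) (u - y))) X w := by
    refine isMinOn_iff.2 fun u hu => ?_
    have h := isMinOn_iff.1 hw.2 u hu
    simpa only [innerSL_apply_apply, smul_eq_mul, bregman, div_eq_inv_mul] using h
  have h := hmin.localize.hasFDerivWithinAt_nonneg hder.hasFDerivWithinAt
    (sub_mem_posTangentConeAt_of_segment_subset (hX.segment_subset hw.1 hp))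
  have h' : 0 ≤ inner ℝ g (p - w) + s⁻¹ * inner ℝ (gradient φ w - gradient φ y) (p - w) := by
    simpa [inner_sub_left] using h
  have h'' := mul_nonneg hs.le h'
  rwa [mul_add, mul_inv_cancel_left₀ hs.ne'] at h''

/-- A step of size `s` moves by at most `G s / σ`. -/
theorem norm_mirror_step_sub_le (hφ : ContDiff ℝ 1 φ) (hX : Convex ℝ X) (hσ : 0 < σ)
    (hsc : ∀ a b, φ a + inner ℝ (gradient φ a) (b - a) + σ / 2 * ‖b - a‖ ^ 2 ≤ φ b)
    (hs : 0 < s) (hw : IsArgminOn X (fun u => inner ℝ g u + bregman φ u y / s) w) (hy : y ∈ X)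
    {G : ℝ} (hg : ‖g‖ ≤ G) : ‖w - y‖ ≤ G * s / σ := by
  have h1 := mirror_step_optimality hφ hX hs hw hy
  have h2 := mul_sq_le_inner_gradient_sub hsc w y
  have h3 : inner ℝ (gradient φ w - gradient φ y) (y - w)
      = -inner ℝ (gradient φ w - gradient φ y) (w - y) := by
    rw [← inner_neg_right, neg_sub]
  have h4 : inner ℝ g (y - w) ≤ G * ‖w - y‖ := by
    rw [norm_sub_rev]
    exact (real_inner_le_norm _ _).trans (mul_le_mul_of_nonneg_right hg (norm_nonneg _))
  have h5 := mul_le_mul_of_nonneg_left h4 hs.le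
  rw [le_div_iff₀ hσ]
  rcases (norm_nonneg (w - y)).eq_or_lt with h0 | h0
  · rw [← h0, zero_mul]
    exact mul_nonneg ((norm_nonneg _).trans hg) hs.le
  · exact le_of_mul_le_mul_right (by nlinarith) h0

/-- Two steps from the same point with the same subgradient and stepsizes `s` and `s (1 - r)` end
at distance at most `G s r / σ`. This puts the state inside its quantization interval. -/
theorem norm_mirror_step_sub_mirror_step_le (hφ : ContDiff ℝ 1 φ) (hX : Convex ℝ X) (hσ : 0 < σ)
    (hsc : ∀ a b, φ a + inner ℝ (gradient φ a) (b - a) + σ / 2 * ‖b - a‖ ^ 2 ≤ φ b)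
    (hs : 0 < s) {r : ℝ} (hr0 : 0 ≤ r) (hr1 : r < 1)
    (hw : IsArgminOn X (fun u => inner ℝ g u + bregman φ u y / s) w)
    {z : EuclideanSpace ℝ (Fin n)}
    (hz : IsArgminOn X (fun u => inner ℝ g u + bregman φ u y / (s * (1 - r))) z)
    {G : ℝ} (hg : ‖g‖ ≤ G) : ‖w - z‖ ≤ G * s * r / σ := by
  have h1 := mirror_step_optimality hφ hX hs hw hz.1
  have h2 := mirror_step_optimality hφ hX (mul_pos hs (sub_pos.2 hr1)) hz hw.1
  have h3 := mul_sq_le_inner_gradient_sub hsc w z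
  rw [← neg_sub w z, inner_neg_right, inner_neg_right] at h1
  have h4 : -inner ℝ g (w - z) ≤ G * ‖w - z‖ := by
    rw [← inner_neg_left]
    exact (real_inner_le_norm _ _).trans
      (mul_le_mul_of_nonneg_right ((norm_neg g).trans_le hg) (norm_nonneg _))
  have h5 := mul_le_mul_of_nonneg_left h4 (mul_nonneg hs.le hr0)
  simp only [inner_sub_left] at h1 h2 h3
  rw [le_div_iff₀ hσ]
  rcases (norm_nonneg (w - z)).eq_or_lt with h0 | h0
  · rw [← h0, zero_mul]
    exact mul_nonneg (mul_nonneg ((norm_nonneg _).trans hg) hs.le) hr0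
  · exact le_of_mul_le_mul_right (by nlinarith) h0

/-- Progress of one step: the linear loss, measured at the point `y` where the step starts, is at
most the decrease of the divergence to `p` plus `G² s / (2 σ)`. -/
theorem inner_sub_le_mirror_step (hφ : ContDiff ℝ 1 φ) (hX : Convex ℝ X) (hσ : 0 < σ)
    (hsc : ∀ a b, φ a + inner ℝ (gradient φ a) (b - a) + σ / 2 * ‖b - a‖ ^ 2 ≤ φ b)
    (hs : 0 < s) (hw : IsArgminOn X (fun u => inner ℝ g u + bregman φ u y / s) w)
    {p : EuclideanSpace ℝ (Fin n)} (hp : p ∈ X) {G : ℝ} (hg : ‖g‖ ≤ G) :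
    inner ℝ g (y - p)
      ≤ G ^ 2 * s / (2 * σ) + (bregman φ p y - bregman φ p w) / s := by
  have h1 := mirror_step_optimality hφ hX hs hw hp
  rw [← bregman_three_point] at h1
  have h2 := half_mul_sq_le_bregman hsc w y
  have h3 : inner ℝ g (y - w) ≤ G * ‖w - y‖ := by
    rw [norm_sub_rev]
    exact (real_inner_le_norm _ _).trans (mul_le_mul_of_nonneg_right hg (norm_nonneg _))
  have h4 : inner ℝ g (y - p) = inner ℝ g (y - w) - inner ℝ g (p - w) := by
    rw [← inner_sub_right]; congr 1; abel
  -- completing the square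
  have h5 : G * ‖w - y‖ * s ≤ G ^ 2 * s ^ 2 / (2 * σ) + σ / 2 * ‖w - y‖ ^ 2 := by
    have h : G ^ 2 * s ^ 2 / (2 * σ) + σ / 2 * ‖w - y‖ ^ 2 - G * ‖w - y‖ * s
        = (G * s - σ * ‖w - y‖) ^ 2 / (2 * σ) := by field_simp; ring
    have : 0 ≤ (G * s - σ * ‖w - y‖) ^ 2 / (2 * σ) := by positivity
    linarith
  have h6 := mul_le_mul_of_nonneg_right h3 hs.le
  have h7 : G ^ 2 * s / (2 * σ) + (bregman φ p y - bregman φ p w) / s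
      = (G ^ 2 * s ^ 2 / (2 * σ) + (bregman φ p y - bregman φ p w)) / s := by field_simp
  rw [h7, le_div_iff₀ hs, h4]
  linarith

end MirrorStep

/-! ### Sums with shifted, geometric and decreasing weights -/

section Sums

theorem sum_range_shift_le {F : ℕ → ℝ} (hF : ∀ m, 0 ≤ F m) {T k M : ℕ} (h : T + k ≤ M) :
    ∑ s ∈ Finset.range T, F (s + k) ≤ ∑ m ∈ Finset.range M, F m := by
  calc ∑ s ∈ Finset.range T, F (s + k)
      ≤ ∑ m ∈ Finset.range k, F m + ∑ s ∈ Finset.range T, F (k + s) := by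
        simp only [add_comm k]
        exact le_add_of_nonneg_left (Finset.sum_nonneg fun m _ => hF m)
    _ = ∑ m ∈ Finset.range (k + T), F m := (Finset.sum_range_add F k T).symm
    _ ≤ ∑ m ∈ Finset.range M, F m :=
        Finset.sum_le_sum_of_subset_of_nonneg (Finset.range_subset_range.2 (by omega))
          fun m _ _ => hF m

theorem geom_sum_le_inv {γ : ℝ} (h0 : 0 ≤ γ) (h1 : γ < 1) (m : ℕ) :
    ∑ k ∈ Finset.range m, γ ^ k ≤ (1 - γ)⁻¹ := by
  have h := mul_neg_geom_sum γ m
  rw [← one_div, le_div_iff₀ (sub_pos.2 h1), mul_comm, h]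
  linarith [pow_nonneg h0 m]

/-- Summing the convolution with a geometric sequence costs a factor `1 / (1 - γ)`. -/
theorem sum_geometric_convolution_le {γ : ℝ} (h0 : 0 ≤ γ) (h1 : γ < 1) {F : ℕ → ℝ}
    (hF : ∀ m, 0 ≤ F m) (M : ℕ) :
    ∑ t ∈ Finset.range M, ∑ k ∈ Finset.range (t + 1), γ ^ (t - k) * F k
      ≤ (1 - γ)⁻¹ * ∑ k ∈ Finset.range M, F k := by
  simp only [Finset.range_eq_Ico]
  rw [← Finset.sum_Ico_Ico_comm, Finset.mul_sum]
  refine Finset.sum_le_sum fun k _ => ?_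
  rw [← Finset.sum_mul, Finset.sum_Ico_eq_sum_range]
  simp only [add_tsub_cancel_left]
  exact mul_le_mul_of_nonneg_right (geom_sum_le_inv h0 h1 _) (hF k)

/-- Telescoping with decreasing stepsizes. The potential `V` is measured where a step starts, the
potential `W` where it ends, and `e` is the increase of the potential between two steps; it is
divided by the stepsize of the step that came before it. -/
theorem sum_potential_div_le {V W a e : ℕ → ℝ} {D : ℝ} (ha : ∀ t, 0 < a t) (hanti : Antitone a)
    (hV : ∀ t, V t ≤ D) (hW : ∀ t, W t ≤ D) (hW0 : ∀ t, 0 ≤ W t) (hVW : ∀ t, V t ≤ W t + e t)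
    (τ T : ℕ) :
    ∑ s ∈ Finset.range T, (V (s + τ) - W (s + τ + 1)) / a (s + τ + 1)
      ≤ D / a (T + τ) + ∑ s ∈ Finset.range T, e (s + τ) / a (s + τ) := by
  have key : ∑ s ∈ Finset.range T, (V (s + τ) - W (s + τ + 1)) / a (s + τ + 1)
      + W (T + τ) / a (T + τ)
      ≤ D / a (T + τ) + ∑ s ∈ Finset.range T, e (s + τ) / a (s + τ) := by
    induction T with
    | zero => simpa using div_le_div_of_nonneg_right (hW τ) (ha τ).le
    | succ T ih =>
      rw [Finset.sum_range_succ, Finset.sum_range_succ, show T + 1 + τ = T + τ + 1 by ring]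
      set t := T + τ
      have hinv : 0 ≤ (a (t + 1))⁻¹ - (a t)⁻¹ :=
        sub_nonneg.2 (inv_anti₀ (ha _) (hanti t.le_succ))
      have h1 := mul_le_mul_of_nonneg_right (hV t) hinv
      have h2 := mul_le_mul_of_nonneg_right (hVW t) (inv_pos.2 (ha t)).le
      simp only [div_eq_mul_inv] at ih ⊢
      linarith
  linarith [div_nonneg (hW0 (T + τ)) (ha (T + τ)).le]

end Sums

/-! ### Consensus of the states -/

section Run

variable {n N : ℕ} {X : Set (EuclideanSpace ℝ (Fin n))}
  {f : Fin N → EuclideanSpace ℝ (Fin n) → ℝ} {φ : EuclideanSpace ℝ (Fin n) → ℝ}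
  {P : ℕ → Matrix (Fin N) (Fin N) ℝ} {α β : ℕ → ℝ} {G σ : ℝ} {τ K : ℕ}
  {x z y : Fin N → ℕ → EuclideanSpace ℝ (Fin n)} {yt g : Fin N → ℤ → EuclideanSpace ℝ (Fin n)}

theorem IsAlgorithmRun.x_mem (hrun : IsAlgorithmRun X f φ P α β G σ τ K x z y yt g) (i t) :
    x i t ∈ X := by
  cases t with
  | zero => exact hrun.x_zero i
  | succ t => exact (hrun.x_succ i t).1

theorem IsAlgorithmRun.yt_mem (hrun : IsAlgorithmRun X f φ P α β G σ τ K x z y yt g) (i)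
    (t : ℕ) : yt i t ∈ X := (hrun.yt_proj i t).1

theorem average_mem (hX : Convex ℝ X) {Q : Matrix (Fin N) (Fin N) ℝ}
    (hQ : Q ∈ doublyStochastic ℝ (Fin N)) {w : Fin N → EuclideanSpace ℝ (Fin n)}
    (hw : ∀ j, w j ∈ X) (i : Fin N) : ∑ j, Q i j • w j ∈ X :=
  hX.sum_mem (fun j _ => (mem_doublyStochastic_iff_sum.1 hQ).1 i j)
    ((mem_doublyStochastic_iff_sum.1 hQ).2.1 i) fun j _ => hw j

theorem norm_average_sub_le {Q : Matrix (Fin N) (Fin N) ℝ}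
    (hQ : Q ∈ doublyStochastic ℝ (Fin N)) {v w : Fin N → EuclideanSpace ℝ (Fin n)} {r : ℝ}
    (h : ∀ j, ‖v j - w j‖ ≤ r) (i : Fin N) :
    ‖∑ j, Q i j • v j - ∑ j, Q i j • w j‖ ≤ r := by
  obtain ⟨hnn, hrow, -⟩ := mem_doublyStochastic_iff_sum.1 hQ
  rw [← Finset.sum_sub_distrib]
  calc ‖∑ j, (Q i j • v j - Q i j • w j)‖ ≤ ∑ j, Q i j * r := by
        refine norm_sum_le_of_le _ fun j _ => ?_
        rw [← smul_sub, norm_smul, Real.norm_of_nonneg (hnn i j)]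
        exact mul_le_mul_of_nonneg_left (h j) (hnn i j)
    _ = r := by rw [← Finset.sum_mul, hrow, one_mul]

theorem quantErr_nonneg (hG : 0 ≤ G) (hσ : 0 < σ) (hα : ∀ t, 0 < α t) (hβ : ∀ t, 0 < β t)
    (t : ℕ) : 0 ≤ quantErr n G σ α β t := by
  have h1 := (hα t).le
  have h2 := (hβ t).le
  unfold quantErr
  positivity

/-- Quantization and projection together displace the average of the states by at most `2 E(t)`:
the average of the unquantized states is feasible, so that the projection does not move away from
it. -/
theorem IsAlgorithmRun.norm_yt_sub_average_le
    (hrun : IsAlgorithmRun X f φ P α β G σ τ K x z y yt g) (hX : Convex ℝ X)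
    (hP : ∀ t, P t ∈ doublyStochastic ℝ (Fin N)) (hφ : ContDiff ℝ 1 φ) (hσ : 0 < σ)
    (hsc : ∀ a b, φ a + inner ℝ (gradient φ a) (b - a) + σ / 2 * ‖b - a‖ ^ 2 ≤ φ b)
    (hα : ∀ t, 0 < α t ∧ α t < 1) (hβ : ∀ t, 0 < β t ∧ β t < 1) (hK : 1 ≤ K) (hG : 0 ≤ G)
    (hGrun : ∀ i, ∀ t : ℕ, ‖g i ((t : ℤ) - τ)‖ ≤ G) (i : Fin N) (t : ℕ) :
    ‖yt i t - ∑ j, P t i j • x j t‖ ≤ 2 * quantErr n G σ α β t := by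
  have hr : 0 ≤ G * α t * β t / σ :=
    div_nonneg (mul_nonneg (mul_nonneg hG (hα t).1.le) (hβ t).1.le) hσ.le
  have hxz : ∀ j, ‖x j t - z j t‖ ≤ G * α t * β t / σ := by
    intro j
    cases t with
    | zero => rwa [hrun.z_zero, sub_self, norm_zero]
    | succ t =>
      exact norm_mirror_step_sub_mirror_step_le hφ hX hσ hsc (hα _).1 (hβ _).1.le (hβ _).2
        (hrun.x_succ j t) (hrun.z_succ j t) (hGrun j t)
  have hquant : ∀ j, ‖quantizeVec K (z j t) (intervalSize n G σ α β t) (x j t) - x j t‖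
      ≤ 2 * quantErr n G σ α β t := by
    intro j
    have h := norm_quantizeVec_sub_le hK hr (d := intervalSize n G σ α β t) (fun _ => rfl) (hxz j)
    have he : quantErr n G σ α β t = n * (G * α t * β t / σ) := by unfold quantErr; ring
    rwa [he]
  refine (norm_proj_sub_le hX (hrun.yt_proj i t)
    (average_mem hX (hP t) (fun j => hrun.x_mem j t) i)).trans ?_
  rw [hrun.y_eq]
  exact norm_average_sub_le (hP t) hquant i

theorem IsAlgorithmRun.norm_x_succ_sub_yt_le
    (hrun : IsAlgorithmRun X f φ P α β G σ τ K x z y yt g) (hX : Convex ℝ X)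
    (hφ : ContDiff ℝ 1 φ) (hσ : 0 < σ)
    (hsc : ∀ a b, φ a + inner ℝ (gradient φ a) (b - a) + σ / 2 * ‖b - a‖ ^ 2 ≤ φ b)
    (hα : ∀ t, 0 < α t ∧ α t < 1) (hGrun : ∀ i, ∀ t : ℕ, ‖g i ((t : ℤ) - τ)‖ ≤ G) (i : Fin N)
    (t : ℕ) : ‖x i (t + 1) - yt i t‖ ≤ G * α (t + 1) / σ :=
  norm_mirror_step_sub_le hφ hX hσ hsc (hα _).1 (hrun.x_succ i t) (hrun.yt_mem i t) (hGrun i t)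

/-- The bound on the distance of the states to their consensus centers at time `t`, when the
iteration of the states is an averaging perturbed by a mirror step and by a quantization. -/
noncomputable def consensusBound (n N B₀ : ℕ) (θ A G σ : ℝ) (α β : ℕ → ℝ) (t : ℕ) : ℝ :=
  omegaConst N θ * gammaConst N B₀ θ ^ t * A
    + ∑ k ∈ Finset.range t, omegaConst N θ * gammaConst N B₀ θ ^ (t - 1 - k)
        * (N * (G * α (k + 1) / σ + 2 * quantErr n G σ α β k))

theorem consensusBound_nonneg {B₀ : ℕ} {θ A : ℝ} (hN : 0 < N) (hθ1 : θ < 1) (hA : 0 ≤ A)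
    (hG : 0 ≤ G) (hσ : 0 < σ) (hα : ∀ t, 0 < α t) (hβ : ∀ t, 0 < β t) (t : ℕ) :
    0 ≤ consensusBound n N B₀ θ A G σ α β t := by
  have hω := omegaConst_pos hN hθ1
  have hγ := gammaConst_pos hN hθ1 B₀
  refine add_nonneg (by positivity) (Finset.sum_nonneg fun k _ => ?_)
  have h1 := (hα (k + 1)).le
  have h2 := quantErr_nonneg (n := n) hG hσ hα hβ k
  positivity

theorem sum_consensusBound_le {B₀ : ℕ} {θ A : ℝ} (hN : 0 < N) (hB₀ : 1 ≤ B₀) (hθ : 0 < θ)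
    (hθ1 : θ < 1) (hA : 0 ≤ A) (hG : 0 ≤ G) (hσ : 0 < σ) (hα : ∀ t, 0 < α t)
    (hβ : ∀ t, 0 < β t) (M : ℕ) :
    ∑ m ∈ Finset.range M, consensusBound n N B₀ θ A G σ α β (m + 1)
      ≤ omegaConst N θ / (1 - gammaConst N B₀ θ) * (A
        + N * (G / σ * ∑ m ∈ Finset.range (M + 1), α m
          + 2 * ∑ m ∈ Finset.range (M + 1), quantErr n G σ α β m)) := by
  have hω := omegaConst_pos hN hθ1
  have hγ0 := gammaConst_pos hN hθ1 B₀
  have hγ1 := gammaConst_lt_one hN hθ hθ1 hB₀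
  set ω := omegaConst N θ
  set γ := gammaConst N B₀ θ
  set e := quantErr n G σ α β with he
  have he0 : ∀ t, 0 ≤ e t := quantErr_nonneg hG hσ hα hβ
  set F : ℕ → ℝ := fun k => N * (G * α (k + 1) / σ + 2 * e k) with hF
  have hF0 : ∀ k, 0 ≤ F k := fun k => by
    have h1 := (hα (k + 1)).le
    have h2 := he0 k
    simp only [hF]
    positivity
  have hgeom : ∑ m ∈ Finset.range M, γ ^ (m + 1) ≤ (1 - γ)⁻¹ := by
    refine le_trans (Finset.sum_le_sum fun m _ => ?_) (geom_sum_le_inv hγ0.le hγ1 M)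
    exact pow_le_pow_of_le_one hγ0.le hγ1.le m.le_succ
  have hα1 : ∑ k ∈ Finset.range M, α (k + 1) ≤ ∑ m ∈ Finset.range (M + 1), α m :=
    sum_range_shift_le (fun m => (hα m).le) le_rfl
  have he1 : ∑ k ∈ Finset.range M, e k ≤ ∑ m ∈ Finset.range (M + 1), e m :=
    sum_range_shift_le (k := 0) he0 (by omega)
  have hFsum : ∑ k ∈ Finset.range M, F k
      ≤ N * (G / σ * ∑ m ∈ Finset.range (M + 1), α m + 2 * ∑ m ∈ Finset.range (M + 1), e m) := by
    have h : ∑ k ∈ Finset.range M, F k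
        = N * (G / σ * ∑ k ∈ Finset.range M, α (k + 1) + 2 * ∑ k ∈ Finset.range M, e k) := by
      simp only [hF, Finset.mul_sum, ← Finset.sum_add_distrib]
      exact Finset.sum_congr rfl fun k _ => by ring
    rw [h]
    gcongr
  have h1γ : 0 < (1 - γ)⁻¹ := inv_pos.2 (sub_pos.2 hγ1)
  calc ∑ m ∈ Finset.range M, consensusBound n N B₀ θ A G σ α β (m + 1)
      = ω * A * ∑ m ∈ Finset.range M, γ ^ (m + 1)
        + ω * ∑ m ∈ Finset.range M, ∑ k ∈ Finset.range (m + 1), γ ^ (m - k) * F k := by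
        simp only [consensusBound, Finset.sum_add_distrib, Finset.mul_sum, add_tsub_cancel_right]
        congr 1
        · exact Finset.sum_congr rfl fun m _ => by ring
        · exact Finset.sum_congr rfl fun m _ => Finset.sum_congr rfl fun k _ => mul_assoc _ _ _
    _ ≤ ω * A * (1 - γ)⁻¹ + ω * ((1 - γ)⁻¹ * ∑ k ∈ Finset.range M, F k) := by
        gcongr
        exact sum_geometric_convolution_le hγ0.le hγ1 hF0 M
    _ ≤ ω * A * (1 - γ)⁻¹ + ω * ((1 - γ)⁻¹ * (N * (G / σ * ∑ m ∈ Finset.range (M + 1), α m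
          + 2 * ∑ m ∈ Finset.range (M + 1), e m))) := by gcongr
    _ = _ := by ring

/-- The states are close to common centers. -/
theorem IsAlgorithmRun.exists_centers
    (hrun : IsAlgorithmRun X f φ P α β G σ τ K x z y yt g) (hX : Convex ℝ X)
    (hP : ∀ t, P t ∈ doublyStochastic ℝ (Fin N)) {B₀ : ℕ} {θ : ℝ} (hconn : IsBConnected P B₀ θ)
    (hφ : ContDiff ℝ 1 φ) (hσ : 0 < σ)
    (hsc : ∀ a b, φ a + inner ℝ (gradient φ a) (b - a) + σ / 2 * ‖b - a‖ ^ 2 ≤ φ b)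
    (hα : ∀ t, 0 < α t ∧ α t < 1) (hβ : ∀ t, 0 < β t ∧ β t < 1) (hK : 1 ≤ K) (hG : 0 ≤ G)
    (hGrun : ∀ i, ∀ t : ℕ, ‖g i ((t : ℤ) - τ)‖ ≤ G) :
    ∃ c : ℕ → EuclideanSpace ℝ (Fin n), ∀ t i,
      ‖x i t - c t‖ ≤ consensusBound n N B₀ θ (∑ j, ‖x j 0‖) G σ α β t := by
  obtain ⟨c, hc⟩ := exists_consensus_centers hP hconn (x := x)
    (u := fun i t => x i (t + 1) - ∑ j, P t i j • x j t) fun i t => (add_sub_cancel _ _).symm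
  refine ⟨c, fun t i => (hc t i).trans (add_le_add le_rfl (Finset.sum_le_sum fun k _ => ?_))⟩
  have hω := omegaConst_pos i.pos hconn.theta_lt_one
  have hγ := gammaConst_pos i.pos hconn.theta_lt_one B₀
  refine mul_le_mul_of_nonneg_left ?_ (by positivity)
  calc ∑ j, ‖x j (k + 1) - ∑ r, P k j r • x r k‖
      ≤ ∑ _j : Fin N, (G * α (k + 1) / σ + 2 * quantErr n G σ α β k) := by
        refine Finset.sum_le_sum fun j _ => ?_
        rw [← sub_add_sub_cancel (x j (k + 1)) (yt j k)]
        exact norm_add_le_of_le (hrun.norm_x_succ_sub_yt_le hX hφ hσ hsc hα hGrun j k)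
          (hrun.norm_yt_sub_average_le hX hP hφ hσ hsc hα hβ hK hG hGrun j k)
    _ = N * (G * α (k + 1) / σ + 2 * quantErr n G σ α β k) := by simp [mul_add]

end Run

/-! ### Convexity of the objective and its subgradients -/

section Objective

variable {n N : ℕ} {X : Set (EuclideanSpace ℝ (Fin n))}
  {f : Fin N → EuclideanSpace ℝ (Fin n) → ℝ}

/-- Jensen's inequality for the objective at a running average. -/
theorem objective_runningAverage_le (hf : ∀ i, ConvexOn ℝ X (f i))
    {x : ℕ → EuclideanSpace ℝ (Fin n)} (hx : ∀ t, x t ∈ X) {T : ℕ} (hT : 1 ≤ T) :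
    objective f (runningAverage x T)
      ≤ 1 / (T : ℝ) * ∑ s ∈ Finset.range T, objective f (x (s + 1)) := by
  have hT' : (T : ℝ) ≠ 0 := by positivity
  have hshift : ∑ t ∈ Finset.Icc 1 T, x t = ∑ s ∈ Finset.range T, x (s + 1) := by
    rw [Finset.range_eq_Ico, Finset.sum_Ico_add' x 0 T 1]
    exact Finset.sum_congr rfl fun _ _ => rfl
  have hi : ∀ i, f i (runningAverage x T)
      ≤ ∑ s ∈ Finset.range T, 1 / (T : ℝ) * f i (x (s + 1)) := by
    intro i
    rw [runningAverage, hshift, Finset.smul_sum]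
    exact (hf i).map_sum_le (fun _ _ => by positivity) (by simp [hT']) fun s _ => hx (s + 1)
  calc objective f (runningAverage x T)
      ≤ 1 / (N : ℝ) * ∑ i, ∑ s ∈ Finset.range T, 1 / (T : ℝ) * f i (x (s + 1)) :=
        mul_le_mul_of_nonneg_left (Finset.sum_le_sum fun i _ => hi i) (by positivity)
    _ = _ := by
        rw [Finset.sum_comm]
        simp only [objective, Finset.mul_sum]
        exact Finset.sum_congr rfl fun s _ => Finset.sum_congr rfl fun i _ => by ring

/-- Existence of bounded subgradients makes a function Lipschitz from above. -/
theorem le_add_mul_norm_sub {h : EuclideanSpace ℝ (Fin n) → ℝ} {G : ℝ}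
    {a b : EuclideanSpace ℝ (Fin n)} (hex : ∃ v ∈ subdifferentialOn X h a, ‖v‖ ≤ G) (hb : b ∈ X) :
    h a ≤ h b + G * ‖b - a‖ := by
  obtain ⟨v, hv, hvG⟩ := hex
  have h1 := hv b hb
  have h2 : -(G * ‖b - a‖) ≤ inner ℝ v (b - a) := by
    rw [neg_le, ← inner_neg_left]
    exact (real_inner_le_norm _ _).trans
      (mul_le_mul_of_nonneg_right ((norm_neg v).trans_le hvG) (norm_nonneg _))
  linarith

end Objective

/-! ### Regret bounds -/

section Regret

variable {n N : ℕ} {X : Set (EuclideanSpace ℝ (Fin n))}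
  {f : Fin N → EuclideanSpace ℝ (Fin n) → ℝ} {φ : EuclideanSpace ℝ (Fin n) → ℝ}
  {P : ℕ → Matrix (Fin N) (Fin N) ℝ} {α β : ℕ → ℝ} {G σ : ℝ} {τ K : ℕ}
  {x z y : Fin N → ℕ → EuclideanSpace ℝ (Fin n)} {yt g : Fin N → ℤ → EuclideanSpace ℝ (Fin n)}

/-- Regret of one local function at the state `p` of an arbitrary agent. The subgradient taken at
`ỹ_i(s)` is used by the step that starts at `ỹ_i(s + τ)`, hence the drift between these points. -/
theorem IsAlgorithmRun.local_regret_le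
    (hrun : IsAlgorithmRun X f φ P α β G σ τ K x z y yt g) (hX : Convex ℝ X)
    (hφ : ContDiff ℝ 1 φ) (hσ : 0 < σ)
    (hsc : ∀ a b, φ a + inner ℝ (gradient φ a) (b - a) + σ / 2 * ‖b - a‖ ^ 2 ≤ φ b)
    (hα : ∀ t, 0 < α t ∧ α t < 1)
    (hGex : ∀ i, ∀ u ∈ X, ∃ v ∈ subdifferentialOn X (f i) u, ‖v‖ ≤ G)
    (hGrun : ∀ i, ∀ t : ℕ, ‖g i ((t : ℤ) - τ)‖ ≤ G) {p q : EuclideanSpace ℝ (Fin n)}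
    (hp : p ∈ X) (hq : q ∈ X) (i : Fin N) (s : ℕ) :
    f i p - f i q ≤ G * ‖yt i s - p‖ + G * ‖yt i (s + τ : ℕ) - yt i s‖
      + (G ^ 2 * α (s + τ + 1) / (2 * σ)
        + (bregman φ q (yt i (s + τ : ℕ)) - bregman φ q (x i (s + τ + 1))) / α (s + τ + 1)) := by
  have hidx : ((s + τ : ℕ) : ℤ) - τ = s := by push_cast; ring
  have hmem := hrun.g_mem i (s + τ)
  have hstep := hrun.x_succ i (s + τ)
  have hg := hGrun i (s + τ)
  rw [hidx] at hmem hstep hg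
  have h1 := le_add_mul_norm_sub (hGex i p hp) (hrun.yt_mem i s)
  have h2 := hmem q hq
  have h3 := inner_sub_le_mirror_step hφ hX hσ hsc (hα _).1 hstep hq hg
  have h4 : inner ℝ (g i s) (q - yt i s)
      = -(inner ℝ (g i s) (yt i (s + τ : ℕ) - q))
        + inner ℝ (g i s) (yt i (s + τ : ℕ) - yt i s) := by
    rw [← inner_neg_right, ← inner_add_right]
    congr 1
    abel
  have h5 : -(G * ‖yt i (s + τ : ℕ) - yt i s‖) ≤ inner ℝ (g i s) (yt i (s + τ : ℕ) - yt i s) := by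
    rw [neg_le, ← inner_neg_left]
    exact (real_inner_le_norm _ _).trans
      (mul_le_mul_of_nonneg_right ((norm_neg _).trans_le hg) (norm_nonneg _))
  linarith

/-- The points `ỹ_i(t)` drift by the quantization error, the mirror step and twice the distance
to the centers per time step. -/
theorem IsAlgorithmRun.norm_yt_add_sub_yt_le
    (hrun : IsAlgorithmRun X f φ P α β G σ τ K x z y yt g) (hX : Convex ℝ X)
    (hP : ∀ t, P t ∈ doublyStochastic ℝ (Fin N)) (hφ : ContDiff ℝ 1 φ) (hσ : 0 < σ)
    (hsc : ∀ a b, φ a + inner ℝ (gradient φ a) (b - a) + σ / 2 * ‖b - a‖ ^ 2 ≤ φ b)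
    (hα : ∀ t, 0 < α t ∧ α t < 1) (hβ : ∀ t, 0 < β t ∧ β t < 1) (hK : 1 ≤ K) (hG : 0 ≤ G)
    (hGrun : ∀ i, ∀ t : ℕ, ‖g i ((t : ℤ) - τ)‖ ≤ G)
    {c : ℕ → EuclideanSpace ℝ (Fin n)} {δ : ℕ → ℝ} (hc : ∀ t i, ‖x i t - c t‖ ≤ δ t)
    (i : Fin N) (s m : ℕ) :
    ‖yt i (s + m : ℕ) - yt i s‖ ≤ ∑ k ∈ Finset.range m,
      (G * α (s + (k + 1)) / σ + 2 * δ (s + (k + 1))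
        + 2 * quantErr n G σ α β (s + (k + 1))) := by
  induction m with
  | zero => simp
  | succ m ih =>
    have h1 := hrun.norm_yt_sub_average_le hX hP hφ hσ hsc hα hβ hK hG hGrun i (s + (m + 1))
    have h2 : ‖∑ j, P (s + (m + 1)) i j • x j (s + (m + 1)) - c (s + (m + 1))‖
        ≤ δ (s + (m + 1)) := by
      have h := norm_average_sub_le (hP (s + (m + 1))) (w := fun _ => c (s + (m + 1)))
        (hc (s + (m + 1))) i
      rwa [← Finset.sum_smul, (mem_doublyStochastic_iff_sum.1 (hP (s + (m + 1)))).2.1,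
        one_smul] at h
    have h3 := hc (s + (m + 1)) i
    rw [norm_sub_rev] at h3
    have h4 := hrun.norm_x_succ_sub_yt_le hX hφ hσ hsc hα hGrun i (s + m)
    rw [add_assoc s m 1] at h4
    rw [Finset.sum_range_succ]
    have htri := norm_add_le_of_le (norm_add_le_of_le h1 h2) (norm_add_le_of_le h3 h4)
    have htot := norm_add_le_of_le ih htri
    simp only [sub_add_sub_cancel] at htot
    rw [add_comm (yt i ((s + m : ℕ) : ℤ) - yt i s), sub_add_sub_cancel] at htot
    linarith

theorem gradient_lipschitz_const_nonneg (hn : 0 < n) {L : ℝ}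
    (hL : ∀ a b, ‖gradient φ a - gradient φ b‖ ≤ L * ‖a - b‖) : 0 ≤ L := by
  have h := hL (EuclideanSpace.single ⟨0, hn⟩ 1) 0
  rw [sub_zero (EuclideanSpace.single _ _), PiLp.norm_single, norm_one, mul_one] at h
  exact (norm_nonneg _).trans h

/-- The divergence to a feasible point, averaged over the agents, increases by at most
`2 L √(2 D / σ) E(t)` when the states are quantized, averaged and projected. -/
theorem IsAlgorithmRun.average_bregman_yt_le
    (hrun : IsAlgorithmRun X f φ P α β G σ τ K x z y yt g) (hX : Convex ℝ X)
    (hP : ∀ t, P t ∈ doublyStochastic ℝ (Fin N)) (hφ : ContDiff ℝ 1 φ) (hσ : 0 < σ)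
    (hsc : ∀ a b, φ a + inner ℝ (gradient φ a) (b - a) + σ / 2 * ‖b - a‖ ^ 2 ≤ φ b)
    {L : ℝ} (hL : ∀ a b, ‖gradient φ a - gradient φ b‖ ≤ L * ‖a - b‖)
    (hVsep : ∀ (a : EuclideanSpace ℝ (Fin n)) (b : Fin N → EuclideanSpace ℝ (Fin n))
      (w : Fin N → ℝ), (∀ j, 0 ≤ w j) → ∑ j, w j = 1 →
        bregman φ a (∑ j, w j • b j) ≤ ∑ j, w j * bregman φ a (b j))
    {D : ℝ} (hD : ∀ a ∈ X, ∀ b ∈ X, bregman φ a b ≤ D)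
    (hα : ∀ t, 0 < α t ∧ α t < 1) (hβ : ∀ t, 0 < β t ∧ β t < 1) (hK : 1 ≤ K) (hG : 0 ≤ G)
    (hGrun : ∀ i, ∀ t : ℕ, ‖g i ((t : ℤ) - τ)‖ ≤ G)
    {q : EuclideanSpace ℝ (Fin n)} (hq : q ∈ X) (hN : 0 < N) (t : ℕ) :
    1 / (N : ℝ) * ∑ i, bregman φ q (yt i t)
      ≤ 1 / (N : ℝ) * ∑ i, bregman φ q (x i t)
        + 2 * L * √(2 * D / σ) * quantErr n G σ α β t := by
  obtain ⟨hnn, hrow, hcol⟩ := mem_doublyStochastic_iff_sum.1 (hP t)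
  have hN' : (0 : ℝ) < N := by exact_mod_cast hN
  have hdiam : ∀ i, ‖q - yt i t‖ ≤ √(2 * D / σ) := by
    intro i
    refine Real.le_sqrt_of_sq_le ?_
    rw [le_div_iff₀ hσ]
    linarith [half_mul_sq_le_bregman hsc q (yt i t), hD q hq _ (hrun.yt_mem i t)]
  have hi : ∀ i, bregman φ q (yt i t)
      ≤ ∑ j, P t i j * bregman φ q (x j t) + 2 * L * √(2 * D / σ) * quantErr n G σ α β t := by
    intro i
    have h1 := bregman_le_bregman_add hσ.le hsc hL q (∑ j, P t i j • x j t) (yt i t)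
    have h2 := hVsep q (fun j => x j t) (P t i) (hnn i) (hrow i)
    have h3 := hrun.norm_yt_sub_average_le hX hP hφ hσ hsc hα hβ hK hG hGrun i t
    rw [norm_sub_rev] at h3
    set b := ∑ j, P t i j • x j t
    -- in dimension zero `L` may be negative, but then the displacement vanishes
    have h4 : L * ‖b - yt i t‖ ≤ L * (2 * quantErr n G σ α β t) := by
      rcases Nat.eq_zero_or_pos n with hn | hn
      · subst hn
        simp [quantErr, Subsingleton.elim b (yt i t)]
      · exact mul_le_mul_of_nonneg_left h3 (gradient_lipschitz_const_nonneg hn hL)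
    have h5 : L * ‖b - yt i t‖ * ‖q - yt i t‖ ≤ L * (2 * quantErr n G σ α β t) * √(2 * D / σ) :=
      mul_le_mul h4 (hdiam i) (norm_nonneg _)
        (((norm_nonneg _).trans (hL b (yt i t))).trans h4)
    linarith
  calc 1 / (N : ℝ) * ∑ i, bregman φ q (yt i t)
      ≤ 1 / (N : ℝ) * ∑ i, (∑ j, P t i j * bregman φ q (x j t)
          + 2 * L * √(2 * D / σ) * quantErr n G σ α β t) :=
        mul_le_mul_of_nonneg_left (Finset.sum_le_sum fun i _ => hi i) (by positivity)
    _ = _ := by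
        rw [Finset.sum_add_distrib, Finset.sum_comm]
        simp only [← Finset.sum_mul, hcol, one_mul, Finset.sum_const, Finset.card_univ,
          Fintype.card_fin, nsmul_eq_mul]
        field_simp

theorem average_le {N : ℕ} (hN : 0 < N) {r : Fin N → ℝ} {M : ℝ} (h : ∀ i, r i ≤ M) :
    1 / (N : ℝ) * ∑ i, r i ≤ M := by
  have hN' : (0 : ℝ) < N := by exact_mod_cast hN
  have h1 := Finset.sum_le_card_nsmul Finset.univ r M fun i _ => h i
  rw [Finset.card_univ, Fintype.card_fin, nsmul_eq_mul] at h1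
  rw [one_div, inv_mul_le_iff₀ hN']
  exact h1

/-- Regret of the objective at the state of one agent `l`, given a bound `δ` on the distances of the
states to common centers. -/
theorem IsAlgorithmRun.objective_regret_le
    (hrun : IsAlgorithmRun X f φ P α β G σ τ K x z y yt g) (hX : Convex ℝ X)
    (hP : ∀ t, P t ∈ doublyStochastic ℝ (Fin N)) (hφ : ContDiff ℝ 1 φ) (hσ : 0 < σ)
    (hsc : ∀ a b, φ a + inner ℝ (gradient φ a) (b - a) + σ / 2 * ‖b - a‖ ^ 2 ≤ φ b)
    (hα : ∀ t, 0 < α t ∧ α t < 1) (hβ : ∀ t, 0 < β t ∧ β t < 1) (hK : 1 ≤ K) (hG : 0 ≤ G)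
    (hGex : ∀ i, ∀ u ∈ X, ∃ v ∈ subdifferentialOn X (f i) u, ‖v‖ ≤ G)
    (hGrun : ∀ i, ∀ t : ℕ, ‖g i ((t : ℤ) - τ)‖ ≤ G)
    {c : ℕ → EuclideanSpace ℝ (Fin n)} {δ : ℕ → ℝ} (hc : ∀ t i, ‖x i t - c t‖ ≤ δ t)
    {q : EuclideanSpace ℝ (Fin n)} (hq : q ∈ X) (l : Fin N) (s : ℕ) :
    objective f (x l (s + 1)) - objective f q
      ≤ G * (G * α (s + 1) / σ + 2 * δ (s + 1))
        + G * ∑ k ∈ Finset.range τ, (G * α (s + (k + 1)) / σ + 2 * δ (s + (k + 1))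
          + 2 * quantErr n G σ α β (s + (k + 1)))
        + G ^ 2 * α (s + τ + 1) / (2 * σ)
        + (1 / (N : ℝ) * ∑ i, bregman φ q (yt i (s + τ : ℕ))
          - 1 / (N : ℝ) * ∑ i, bregman φ q (x i (s + τ + 1))) / α (s + τ + 1) := by
  set S := ∑ k ∈ Finset.range τ, (G * α (s + (k + 1)) / σ + 2 * δ (s + (k + 1))
    + 2 * quantErr n G σ α β (s + (k + 1)))
  have hi : ∀ i, f i (x l (s + 1)) - f i q
      - (bregman φ q (yt i (s + τ : ℕ)) - bregman φ q (x i (s + τ + 1)))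
        / α (s + τ + 1)
      ≤ G * (G * α (s + 1) / σ + 2 * δ (s + 1)) + G * S + G ^ 2 * α (s + τ + 1) / (2 * σ) := by
    intro i
    have h1 := hrun.local_regret_le hX hφ hσ hsc hα hGex hGrun (hrun.x_mem l (s + 1)) hq i s
    have h2 := hrun.norm_yt_add_sub_yt_le hX hP hφ hσ hsc hα hβ hK hG hGrun hc i s τ
    have h3 : ‖yt i s - x l (s + 1)‖ ≤ G * α (s + 1) / σ + 2 * δ (s + 1) := by
      have h4 := hrun.norm_x_succ_sub_yt_le hX hφ hσ hsc hα hGrun i s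
      have h5 := hc (s + 1) i
      have h6 := hc (s + 1) l
      rw [norm_sub_rev] at h4 h6
      have h7 := norm_add_le_of_le h4 (norm_add_le_of_le h5 h6)
      rw [sub_add_sub_cancel, sub_add_sub_cancel] at h7
      linarith
    have h8 := mul_le_mul_of_nonneg_left h2 hG
    have h9 := mul_le_mul_of_nonneg_left h3 hG
    linarith
  have h := average_le l.pos hi
  have hexp : 1 / (N : ℝ) * ∑ i, (f i (x l (s + 1)) - f i q
      - (bregman φ q (yt i (s + τ : ℕ)) - bregman φ q (x i (s + τ + 1)))
        / α (s + τ + 1))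
      = objective f (x l (s + 1)) - objective f q
        - (1 / (N : ℝ) * ∑ i, bregman φ q (yt i (s + τ : ℕ))
        - 1 / (N : ℝ) * ∑ i, bregman φ q (x i (s + τ + 1))) / α (s + τ + 1) := by
    simp only [objective, Finset.sum_sub_distrib, ← Finset.sum_div]
    ring
  rw [hexp] at h
  linarith

/-- The comparison of coefficients, with `R = √(2 D / σ)` and `c₁ = ω / (1 - γ)`. It uses
`B = N (2 + N c₁)` only through `N c₁ ≤ B` and, in the term without delay, `B / N = 2 + N c₁`. The
terms with `E² / α` are not needed. -/
theorem regret_coefficients_le {N B A G σ τ c₁ L R D' Sα Se Sq Sr : ℝ} (hN1 : 1 ≤ N)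
    (hA0 : 0 ≤ A) (hG : 0 ≤ G) (hσ : 0 < σ) (hτ : 0 ≤ τ) (hc₁0 : 0 ≤ c₁) (hR : 0 ≤ R)
    (hSα0 : 0 ≤ Sα) (hSe0 : 0 ≤ Se) (hLSq : 0 ≤ L * Sq) (hLSr : 0 ≤ L * Sr)
    (hB : B = 2 * N + N ^ 2 * c₁) :
    G * (G / σ * Sα + 2 * (c₁ * (A + N * (G / σ * Sα + 2 * Se))))
        + G * (τ * (G / σ * Sα + 2 * (c₁ * (A + N * (G / σ * Sα + 2 * Se))) + 2 * Se))
        + G ^ 2 / (2 * σ) * Sα + (D' + 2 * L * R * Sr)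
      ≤ ((2 * B + 1) * G ^ 2 * τ / σ + G ^ 2 / (2 * σ) + 2 * B * G ^ 2 / (N * σ)) * Sα
        + ((6 * B + 3) * N * G * τ + 6 * B * G + 3 * N * G) * Se
        + (2 * N * A * G * τ * c₁ + 2 * A * G * c₁)
        + L * (8 * N ^ 2 + 2) * Sq + (2 * N + 1) * L * R * Sr + D' := by
  have hN' : 0 < N := zero_lt_one.trans_le hN1
  have hNB : N * c₁ ≤ B := by
    rw [hB]
    nlinarith [mul_nonneg (mul_nonneg hN'.le hc₁0) (sub_nonneg.2 hN1)]
  have hB0 : 0 ≤ B := (mul_nonneg hN'.le hc₁0).trans hNB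
  have t1 : 0 ≤ (G ^ 2 / σ * Sα) * (τ * (2 * (B - N * c₁)) + 3) := by
    have := sub_nonneg.2 hNB
    positivity
  have t2 : 0 ≤ G * Se * (τ * ((6 * B + 3) * N - 4 * (N * c₁) - 2)
      + (6 * B + 3 * N - 4 * (N * c₁))) := by
    have h1 : 0 ≤ (6 * B + 3) * N - 4 * (N * c₁) - 2 := by
      nlinarith [mul_nonneg hB0 (sub_nonneg.2 hN1)]
    have h2 : 0 ≤ 6 * B + 3 * N - 4 * (N * c₁) := by linarith
    positivity
  have t3 : 0 ≤ 2 * A * G * c₁ * τ * (N - 1) := by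
    have := sub_nonneg.2 hN1
    positivity
  have t4 : 0 ≤ L * Sq * (8 * N ^ 2 + 2) := mul_nonneg hLSq (by positivity)
  have t5 : 0 ≤ L * Sr * R * (2 * N - 1) :=
    mul_nonneg (mul_nonneg hLSr hR) (by linarith)
  have hBN : 2 * B * G ^ 2 / (N * σ) = G ^ 2 / σ * (4 + 2 * (N * c₁)) := by
    rw [hB]
    field_simp
    ring
  have hBτ : (2 * B + 1) * G ^ 2 * τ / σ = G ^ 2 / σ * ((2 * B + 1) * τ) := by ring
  rw [hBN, hBτ]
  linear_combination t1 + t2 + t3 + t4 + t5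

end Regret

theorem theorem1 {n N : ℕ}
    -- feasible set, local functions, and a solution of the constrained problem
    (X : Set (EuclideanSpace ℝ (Fin n))) (hXconv : Convex ℝ X) (hXcomp : IsCompact X)
    (f : Fin N → EuclideanSpace ℝ (Fin n) → ℝ) (hf : ∀ i, ConvexOn ℝ X (f i))
    (xstar : EuclideanSpace ℝ (Fin n)) (hxstar : IsArgminOn X (objective f) xstar)
    -- communication weights
    (P : ℕ → Matrix (Fin N) (Fin N) ℝ) (hP : ∀ t, P t ∈ doublyStochastic ℝ (Fin N))
    (B₀ : ℕ) (θ : ℝ) (hconn : IsBConnected P B₀ θ)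
    -- distance generating function
    (φ : EuclideanSpace ℝ (Fin n) → ℝ) (hφ : ContDiff ℝ 1 φ)
    (σ : ℝ) (hσ : 0 < σ)
    (hφsc : ∀ a b, φ a + inner ℝ (gradient φ a) (b - a) + σ / 2 * ‖b - a‖ ^ 2 ≤ φ b)
    (L : ℝ) (hφL : ∀ a b, ‖gradient φ a - gradient φ b‖ ≤ L * ‖a - b‖)
    (hVsep : ∀ (a : EuclideanSpace ℝ (Fin n)) (b : Fin N → EuclideanSpace ℝ (Fin n))
      (w : Fin N → ℝ), (∀ j, 0 ≤ w j) → ∑ j, w j = 1 →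
        bregman φ a (∑ j, w j • b j) ≤ ∑ j, w j * bregman φ a (b j))
    (D : ℝ) (hD : ∀ a ∈ X, ∀ b ∈ X, bregman φ a b ≤ D)
    -- stepsizes, quantization parameters, delay and number of quantization cells
    (α β : ℕ → ℝ) (hα : ∀ t, 0 < α t ∧ α t < 1) (hαanti : Antitone α)
    (hβ : ∀ t, 0 < β t ∧ β t < 1) (hβanti : Antitone β)
    (τ K : ℕ) (hK : 1 ≤ K)
    -- the algorithm
    (G : ℝ) (x z y : Fin N → ℕ → EuclideanSpace ℝ (Fin n))
    (yt g : Fin N → ℤ → EuclideanSpace ℝ (Fin n))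
    (hrun : IsAlgorithmRun X f φ P α β G σ τ K x z y yt g)
    -- subgradients bounded by `G`: available at every feasible point, and used by the algorithm
    (hGex : ∀ i, ∀ u ∈ X, ∃ v ∈ subdifferentialOn X (f i) u, ‖v‖ ≤ G)
    (hGrun : ∀ i, ∀ t : ℕ, ‖g i ((t : ℤ) - τ)‖ ≤ G)
    -- the constants `A` and `B` of the bound
    (A : ℝ) (hA : A = ∑ j, ‖x j 0‖)
    (B : ℝ) (hB : B = 2 * N + (N : ℝ) ^ 2 * omegaConst N θ / (1 - gammaConst N B₀ θ))
    (l : Fin N) (T : ℕ) (hT : 1 ≤ T) :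
    objective f (runningAverage (x l) T) - objective f xstar ≤
      ((2 * B + 1) * G ^ 2 * τ / σ + G ^ 2 / (2 * σ) + 2 * B * G ^ 2 / (N * σ))
          * ((1 / (T : ℝ)) * ∑ t ∈ Finset.range (T + τ + 1), α t)
        + ((6 * B + 3) * N * G * τ + 6 * B * G + 3 * N * G)
          * ((1 / (T : ℝ)) * ∑ t ∈ Finset.range (T + τ + 1), quantErr n G σ α β t)
        + (2 * N * A * G * τ * omegaConst N θ / (1 - gammaConst N B₀ θ)
            + 2 * A * G * omegaConst N θ / (1 - gammaConst N B₀ θ)) * (1 / (T : ℝ))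
        + L * (8 * (N : ℝ) ^ 2 + 2) / T
          * ∑ t ∈ Finset.range (T + τ + 1), quantErr n G σ α β t ^ 2 / α t
        + (2 * N + 1) * L / T * Real.sqrt (2 * D / σ)
          * ∑ t ∈ Finset.range (T + τ + 1), quantErr n G σ α β t / α t
        + D / (T * α (T + τ)) := by
  have hN : 0 < N := l.pos
  have hN1 : (1 : ℝ) ≤ N := by exact_mod_cast hN
  have hT' : (0 : ℝ) < T := by exact_mod_cast hT
  have hq := hxstar.1
  have hG : 0 ≤ G := by
    obtain ⟨v, -, hv⟩ := hGex l xstar hq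
    exact (norm_nonneg v).trans hv
  have hα0 : ∀ t, 0 < α t := fun t => (hα t).1
  have hβ0 : ∀ t, 0 < β t := fun t => (hβ t).1
  have hA0 : 0 ≤ A := hA ▸ Finset.sum_nonneg fun j _ => norm_nonneg _
  obtain ⟨c, hc⟩ := hrun.exists_centers hXconv hP hconn hφ hσ hφsc hα hβ hK hG hGrun
  rw [← hA] at hc
  set e := quantErr n G σ α β with he
  set δ := consensusBound n N B₀ θ A G σ α β
  have he0 : ∀ t, 0 ≤ e t := quantErr_nonneg hG hσ hα0 hβ0
  have hδ0 : ∀ t, 0 ≤ δ t := consensusBound_nonneg hN hconn.theta_lt_one hA0 hG hσ hα0 hβ0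
  have hLe : ∀ t, 0 ≤ L * e t := by
    intro t
    rcases Nat.eq_zero_or_pos n with hn | hn
    · have h : e t = 0 := by simp [he, quantErr, hn]
      rw [h, mul_zero]
    · exact mul_nonneg (gradient_lipschitz_const_nonneg hn hφL) (he0 t)
  set V : ℕ → ℝ := fun t => 1 / (N : ℝ) * ∑ i, bregman φ xstar (yt i t)
  set W : ℕ → ℝ := fun t => 1 / (N : ℝ) * ∑ i, bregman φ xstar (x i t)
  -- `H m` bounds the distance of `ỹ_i(m - 1)` to the state of any agent at time `m`
  set H : ℕ → ℝ := fun m => G * α m / σ + 2 * δ m with hH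
  have hH0 : ∀ m, 0 ≤ H m := fun m => by
    have h1 := (hα0 m).le
    have h2 := hδ0 m
    simp only [hH]
    positivity
  have hF0 : ∀ m, 0 ≤ H m + 2 * e m := fun m => by
    have h1 := hH0 m
    have h2 := he0 m
    positivity
  have hregret := hrun.objective_regret_le hXconv hP hφ hσ hφsc hα hβ hK hG hGex hGrun hc hq l
  set κ := 2 * L * √(2 * D / σ) with hκ
  have hpot := sum_potential_div_le (V := V) (W := W) (e := fun t => κ * e t) (D := D) hα0 hαanti
    (fun t => average_le hN fun i => hD _ hq _ (hrun.yt_mem i t))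
    (fun t => average_le hN fun i => hD _ hq _ (hrun.x_mem i t))
    (fun t => mul_nonneg (by positivity) (Finset.sum_nonneg fun i _ =>
      (by positivity : 0 ≤ σ / 2 * ‖xstar - x i t‖ ^ 2).trans (half_mul_sq_le_bregman hφsc _ _)))
    (fun t => hrun.average_bregman_yt_le hXconv hP hφ hσ hφsc hφL hVsep hD hα hβ hK hG hGrun
      hq hN t) τ T
  set Sα := ∑ t ∈ Finset.range (T + τ + 1), α t
  set Se := ∑ t ∈ Finset.range (T + τ + 1), e t
  set Sr := ∑ t ∈ Finset.range (T + τ + 1), e t / α t with hSr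
  set Sq := ∑ t ∈ Finset.range (T + τ + 1), e t ^ 2 / α t with hSq
  have hSα0 : 0 ≤ Sα := Finset.sum_nonneg fun t _ => (hα0 t).le
  have hSe0 : 0 ≤ Se := Finset.sum_nonneg fun t _ => he0 t
  have hLSr : 0 ≤ L * Sr := by
    rw [hSr, Finset.mul_sum]
    refine Finset.sum_nonneg fun t _ => ?_
    rw [← mul_div_assoc]
    exact div_nonneg (hLe t) (hα0 t).le
  have hLSq : 0 ≤ L * Sq := by
    rw [hSq, Finset.mul_sum]
    refine Finset.sum_nonneg fun t _ => ?_
    rw [← mul_div_assoc, pow_two, ← mul_assoc]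
    exact div_nonneg (mul_nonneg (hLe t) (he0 t)) (hα0 t).le
  have hpotr : ∑ s ∈ Finset.range T, κ * e (s + τ) / α (s + τ) ≤ κ * Sr := by
    rw [hSr, Finset.mul_sum]
    simp only [← mul_div_assoc]
    refine sum_range_shift_le (F := fun t => κ * e t / α t) (fun t => ?_) (by omega)
    refine div_nonneg ?_ (hα0 t).le
    have h := mul_nonneg (hLe t) (Real.sqrt_nonneg (2 * D / σ))
    rw [hκ]
    linarith
  set c₁ := omegaConst N θ / (1 - gammaConst N B₀ θ) with hc₁
  have hc₁0 : 0 ≤ c₁ := div_nonneg (omegaConst_pos hN hconn.theta_lt_one).le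
    (sub_nonneg.2 (gammaConst_lt_one hN hconn.theta_pos hconn.theta_lt_one hconn.block_pos).le)
  have hHsum : ∑ m ∈ Finset.range (T + τ), H (m + 1)
      ≤ G / σ * Sα + 2 * (c₁ * (A + N * (G / σ * Sα + 2 * Se))) := by
    have h1 := sum_consensusBound_le (n := n) hN hconn.block_pos hconn.theta_pos
      hconn.theta_lt_one hA0 hG hσ hα0 hβ0 (T + τ)
    have h2 : ∑ m ∈ Finset.range (T + τ), α (m + 1) ≤ Sα :=
      sum_range_shift_le (fun m => (hα0 m).le) le_rfl
    have h3 : ∑ m ∈ Finset.range (T + τ), H (m + 1)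
        = G / σ * ∑ m ∈ Finset.range (T + τ), α (m + 1)
          + 2 * ∑ m ∈ Finset.range (T + τ), δ (m + 1) := by
      simp only [hH, Finset.mul_sum, ← Finset.sum_add_distrib]
      exact Finset.sum_congr rfl fun k _ => by ring
    rw [h3]
    gcongr
  have hesum : ∑ m ∈ Finset.range (T + τ), e (m + 1) ≤ Se := sum_range_shift_le he0 le_rfl
  set M := G / σ * Sα + 2 * (c₁ * (A + N * (G / σ * Sα + 2 * Se)))
  have hHT : ∑ s ∈ Finset.range T, H (s + 1) ≤ M :=
    (sum_range_shift_le (F := fun m => H (m + 1)) (k := 0) (fun m => hH0 _) (by omega)).trans hHsum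
  have hdelay : ∑ s ∈ Finset.range T, ∑ k ∈ Finset.range τ,
      (H (s + (k + 1)) + 2 * e (s + (k + 1))) ≤ τ * (M + 2 * Se) := by
    rw [Finset.sum_comm]
    calc ∑ k ∈ Finset.range τ, ∑ s ∈ Finset.range T, (H (s + (k + 1)) + 2 * e (s + (k + 1)))
        ≤ ∑ _k ∈ Finset.range τ, (M + 2 * Se) := by
          refine Finset.sum_le_sum fun k hk => ?_
          refine (sum_range_shift_le (F := fun m => H (m + 1) + 2 * e (m + 1)) (M := T + τ)
            (fun m => hF0 (m + 1)) (by have := Finset.mem_range.1 hk; omega)).trans ?_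
          rw [Finset.sum_add_distrib, ← Finset.mul_sum]
          linarith
      _ = τ * (M + 2 * Se) := by rw [Finset.sum_const, Finset.card_range, nsmul_eq_mul]
  have hαT : ∑ s ∈ Finset.range T, α (s + τ + 1) ≤ Sα :=
    sum_range_shift_le (k := τ + 1) (fun m => (hα0 m).le) (by omega)
  have hsum : ∑ s ∈ Finset.range T, (objective f (x l (s + 1)) - objective f xstar)
      ≤ G * M + G * (τ * (M + 2 * Se)) + G ^ 2 / (2 * σ) * Sα + (D / α (T + τ) + κ * Sr) := by
    refine (Finset.sum_le_sum fun s _ => hregret s).trans ?_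
    have h1 : ∑ s ∈ Finset.range T, G ^ 2 * α (s + τ + 1) / (2 * σ)
        = G ^ 2 / (2 * σ) * ∑ s ∈ Finset.range T, α (s + τ + 1) := by
      rw [Finset.mul_sum]
      exact Finset.sum_congr rfl fun s _ => by ring
    rw [Finset.sum_add_distrib, Finset.sum_add_distrib, Finset.sum_add_distrib, ← Finset.mul_sum,
      ← Finset.mul_sum, h1]
    exact add_le_add (add_le_add (add_le_add (mul_le_mul_of_nonneg_left hHT hG)
      (mul_le_mul_of_nonneg_left hdelay hG)) (mul_le_mul_of_nonneg_left hαT (by positivity)))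
      (hpot.trans (add_le_add le_rfl hpotr))
  have hJ := objective_runningAverage_le hf (fun t => hrun.x_mem l t) hT
  have hmean : objective f (runningAverage (x l) T) - objective f xstar
      ≤ 1 / (T : ℝ) * ∑ s ∈ Finset.range T, (objective f (x l (s + 1)) - objective f xstar) := by
    rw [Finset.sum_sub_distrib, mul_sub]
    simp only [Finset.sum_const, Finset.card_range, nsmul_eq_mul]
    rw [← mul_assoc (1 / (T : ℝ)) (T : ℝ), one_div_mul_cancel hT'.ne', one_mul]
    linarith
  have hBc : B = 2 * N + N ^ 2 * c₁ := by rw [hB, hc₁, mul_div_assoc]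
  calc objective f (runningAverage (x l) T) - objective f xstar
      ≤ 1 / (T : ℝ) * (G * M + G * (τ * (M + 2 * Se)) + G ^ 2 / (2 * σ) * Sα
          + (D / α (T + τ) + κ * Sr)) :=
        hmean.trans (mul_le_mul_of_nonneg_left hsum (by positivity))
    _ ≤ 1 / (T : ℝ) * (((2 * B + 1) * G ^ 2 * τ / σ + G ^ 2 / (2 * σ)
          + 2 * B * G ^ 2 / (N * σ)) * Sα
        + ((6 * B + 3) * N * G * τ + 6 * B * G + 3 * N * G) * Se
        + (2 * N * A * G * τ * c₁ + 2 * A * G * c₁)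
        + L * (8 * (N : ℝ) ^ 2 + 2) * Sq
        + (2 * N + 1) * L * √(2 * D / σ) * Sr + D / α (T + τ)) :=
        mul_le_mul_of_nonneg_left (regret_coefficients_le hN1 hA0 hG hσ (Nat.cast_nonneg τ) hc₁0
          (Real.sqrt_nonneg _) hSα0 hSe0 hLSq hLSr hBc) (by positivity)
    _ = _ := by
        rw [hc₁]
        ring
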